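/- Let $K$ be a finite field, let $S=K[t_1,\ldots,t_s]$ have the standard grading and the graded reverse lexicographic order $\prec$ ($t^a\succ t^b$ if $\deg t^a>\deg t^b$, or $\deg t^a=\deg t^b$ and the last non-zero entry of $a-b$ is negative), and let $\mathbb{X}=\{[P_1],\ldots,[P_m]\}$ be a set of $m\ge 2$ distinct points of $\mathbb{P}^{s-1}$ over $K$, with representatives satisfying $t_s(P_i)=1$ for all $i$. Let $I\subset S$ be the vanishing ideal of $\mathbb{X}$, generated by the homogeneous polynomials that vanish at all points of $\mathbb{X}$, and let $\mathfrak{p}_i$ be the vanishing ideal of $[P_i]$. Let $b_{i,j}$ be the graded Betti numbers of the minimal graded free resolution of $S/I$, so that $F_i=\bigoplus_j S(-j)^{b_{i,j}}$, let ${\rm reg}(S/I)=\max\{j-i\mid b_{i,j}\neq 0\}$, and let $g$ be the projective dimension of $S/I$. Suppose that $I$ is Gorenstein, that is, there is a unique $j$ with $b_{g,j}\neq 0$, and $b_{g,j}=1$ for this $j$. Let $\Delta_\prec(I)$ be the set of standard monomials (the monomials not in the initial ideal ${\rm in}_\prec(I)$), $\Delta_\prec(I)_d$ the set of those of degree $d$,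 and write $K\Gamma$ for the $K$-span of a set $\Gamma$ of monomials. The remainder on division of $f\in S$ by $I$ is the unique $r\in K\Delta_\prec(I)$ with $f-r\in I$. The $i$-th standard indicator function $f_i$ is the homogeneous polynomial in $K\Delta_\prec(I)$, unique up to a non-zero scalar, of degree ${\rm v}_{\mathfrak{p}_i}(I)=\min\{d\ge 0\mid (I\colon f)=\mathfrak{p}_i\text{ for some }f\in S_d\}$ with $f_i(P_i)\neq 0$ and $f_i(P_j)=0$ for $j\neq i$. A standard monomial is essential if it appears in each of $f_1,\ldots,f_m$. Let ${\rm ev}_d\colon S_d\to K^m$ be the map $f\mapsto(f(P_1),\ldots,f(P_m))$, let $C^\perp$ be the dual of $C\subset K^m$ with respect to the ordinary inner product, and let $\gamma\cdot C=\{(\gamma_1c_1,\ldots,\gamma_mc_m)\mid c\in C\}$. Then there is a unique essential monomial $t^a$ such that $t_s$ does not divide $t^a$. Moreover, for all $d,k\ge 0$ and all $\Gamma_1\subset\Delta_\prec(I)_d$, $\Gamma_2\subset\Delta_\prec(I)_k$ satisfying 1. $d+k\le{\rm reg}(S/I)$, 2. $|\Gamma_1|+|\Gamma_2|=|\mathbb{X}|$,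 3. $t^a$ does not appear in the remainder on division of $u_1u_2$ by $I$ for every $u_1\in\Gamma_1$, $u_2\in\Gamma_2$, one has $$\gamma\cdot{\rm ev}_d(K\Gamma_1)={\rm ev}_k(K\Gamma_2)^\perp,$$ where $\gamma=(\beta_1f_1(P_1)^{-1},\ldots,\beta_mf_m(P_m)^{-1})$ and $\beta_i$ is the coefficient of $t^a$ in $f_i$. -/

import Mathlib

open MvPolynomial

namespace ProjEval

/-! ### Minimal graded free resolutions, regularity, Gorenstein ideals -/

/-- A minimal graded free resolution
`0 → F_g → ⋯ → F_1 → F_0 = S → S/I → 0` of `S/I`, where `S = K[t_σ]` has the standard grading.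
The module `F_i` is `⨁_a S(-shift i a)`, with `a` running over `Fin (rank i)`, and the map
`F_{i+1} → F_i` is given by the matrix `d i`. -/
structure MinGradedFreeResolution {σ K : Type*} [Field K] (I : Ideal (MvPolynomial σ K)) where
  /-- the rank of `F_i` -/
  rank : ℕ → ℕ
  /-- the degrees of the basis elements of `F_i` -/
  shift : (i : ℕ) → Fin (rank i) → ℕ
  /-- the differential `F_{i+1} → F_i` -/
  d : (i : ℕ) → Matrix (Fin (rank i)) (Fin (rank (i + 1))) (MvPolynomial σ K)
  /-- `F_0` has rank one -/
  rank_zero : rank 0 = 1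
  /-- the generator of `F_0 = S` has degree zero -/
  shift_zero : ∀ a, shift 0 a = 0
  /-- the resolution has finite length -/
  finite : ∃ N, ∀ i, N < i → rank i = 0
  /-- the differentials are homogeneous of degree zero -/
  graded : ∀ i a b, d i a b ≠ 0 →
    ∃ e, e + shift i a = shift (i + 1) b ∧ (d i a b).IsHomogeneous e
  /-- the image of `F_1` in `F_0 = S` is `I` -/
  range_zero : ∀ x : Fin (rank 0) → MvPolynomial σ K,
    x ∈ LinearMap.range (d 0).mulVecLin ↔ ∀ a, x a ∈ I
  /-- exactness at `F_{i+1}` -/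
  exact : ∀ i, LinearMap.ker (d i).mulVecLin = LinearMap.range (d (i + 1)).mulVecLin
  /-- minimality: all matrix entries lie in the ideal generated by the variables -/
  minimal : ∀ i a b, constantCoeff (d i a b) = 0

/-- The graded Betti number `b_{i,j}`: the number of copies of `S(-j)` in `F_i`. -/
def MinGradedFreeResolution.betti {σ K : Type*} [Field K] {I : Ideal (MvPolynomial σ K)}
    (F : MinGradedFreeResolution I) (i j : ℕ) : ℕ :=
  (Finset.univ.filter fun a : Fin (F.rank i) => F.shift i a = j).card

/-- `g` is the length of the resolution, that is, the projective dimension of `S/I`. -/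
def MinGradedFreeResolution.HasLength {σ K : Type*} [Field K] {I : Ideal (MvPolynomial σ K)}
    (F : MinGradedFreeResolution I) (g : ℕ) : Prop :=
  IsGreatest {i | F.rank i ≠ 0} g

/-- The Castelnuovo–Mumford regularity `reg(S/I) = max {j - i | b_{i,j} ≠ 0}`, where the `b_{i,j}`
are the graded Betti numbers of the minimal graded free resolution of `S/I` (which is unique up to
isomorphism). -/
noncomputable def reg {σ K : Type*} [Field K] (I : Ideal (MvPolynomial σ K)) : ℤ :=
  sSup {n : ℤ | ∃ (F : MinGradedFreeResolution I) (i j : ℕ),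
    F.betti i j ≠ 0 ∧ n = (j : ℤ) - (i : ℤ)}

/-- `I` is Gorenstein: with `g` the projective dimension of `S/I`, there is a unique `j` such that
`b_{g,j} ≠ 0`, and `b_{g,j} = 1`. -/
def IsGorenstein {σ K : Type*} [Field K] (I : Ideal (MvPolynomial σ K)) : Prop :=
  ∃ (F : MinGradedFreeResolution I) (g : ℕ), F.HasLength g ∧
    ∃ j, F.betti g j = 1 ∧ ∀ j', j' ≠ j → F.betti g j' = 0

/-! ### The graded reverse lexicographic order, standard monomials, remainders -/

/-- `GRevLexLT a b` means `t^a ≺ t^b` in the graded reverse lexicographic order: the degree of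
`t^a` is smaller, or the degrees agree and the last non-zero entry of `b - a` is negative. -/
def GRevLexLT {n : ℕ} (a b : Fin n →₀ ℕ) : Prop :=
  a.degree < b.degree ∨
    (a.degree = b.degree ∧ ∃ j, b j < a j ∧ ∀ i, j < i → a i = b i)

/-- `t^a` is the initial monomial of the (non-zero) polynomial `f`. -/
def IsInitialMonomial {n : ℕ} {K : Type*} [Field K] (f : MvPolynomial (Fin n) K)
    (a : Fin n →₀ ℕ) : Prop :=
  a ∈ f.support ∧ ∀ b ∈ f.support, b ≠ a → GRevLexLT b a

/-- The initial ideal of `I`. -/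
noncomputable def initialIdeal {n : ℕ} {K : Type*} [Field K] (I : Ideal (MvPolynomial (Fin n) K)) :
    Ideal (MvPolynomial (Fin n) K) :=
  Ideal.span {u | ∃ f ∈ I, ∃ a, IsInitialMonomial f a ∧ u = monomial a 1}

/-- The footprint `Δ_≺(I)`: the exponents of the monomials outside the initial ideal. -/
def footprint {n : ℕ} {K : Type*} [Field K] (I : Ideal (MvPolynomial (Fin n) K)) :
    Set (Fin n →₀ ℕ) :=
  {a | monomial a (1 : K) ∉ initialIdeal I}

/-- The standard monomials of degree `d`. -/
def footprintDeg {n : ℕ} {K : Type*} [Field K] (I : Ideal (MvPolynomial (Fin n) K)) (d : ℕ) :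
    Set (Fin n →₀ ℕ) :=
  {a | a ∈ footprint I ∧ a.degree = d}

/-- `r` is the remainder on division of `f` by `I`: `r ∈ KΔ_≺(I)` and `f = g + r` with `g ∈ I`.
Here `restrictSupport K Δ` is the `K`-span of the monomials with exponent in `Δ`. -/
def IsRemainder {n : ℕ} {K : Type*} [Field K] (I : Ideal (MvPolynomial (Fin n) K))
    (f r : MvPolynomial (Fin n) K) : Prop :=
  r ∈ restrictSupport K (footprint I) ∧ ∃ g ∈ I, f = g + r

/-! ### Vanishing ideals, v-numbers, indicator functions -/

/-- The graded vanishing ideal of the set of projective points `[P i]`: it is generated by the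
homogeneous polynomials that vanish at all of the points. -/
noncomputable def vanishingIdeal {n : ℕ} {K ι : Type*} [Field K] (P : ι → Fin n → K) :
    Ideal (MvPolynomial (Fin n) K) :=
  Ideal.span {f | (∃ d, f.IsHomogeneous d) ∧ ∀ i, eval (P i) f = 0}

/-- The vanishing ideal of the single projective point `[p]`. -/
noncomputable def pointIdeal {n : ℕ} {K : Type*} [Field K] (p : Fin n → K) : Ideal (MvPolynomial (Fin n) K) :=
  vanishingIdeal fun _ : Unit => p

/-- The local v-number `min {d | ∃ f ∈ S_d, (I : f) = 𝔭_i}` of `I = I(𝕏)` at the vanishing ideal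
`𝔭_i` of `[P i]`. -/
noncomputable def vNumber {n : ℕ} {K ι : Type*} [Field K] (P : ι → Fin n → K) (i : ι) : ℕ :=
  sInf {d | ∃ f : MvPolynomial (Fin n) K,
    f.IsHomogeneous d ∧ (vanishingIdeal P).colon {f} = pointIdeal (P i)}

/-- `f` is an `i`-th standard indicator function (these differ only by non-zero scalars): it is
homogeneous of degree `v_{𝔭_i}(I)`, it is non-zero at `[P i]`, it vanishes at the other points, and
it is a linear combination of standard monomials. -/
def IsStandardIndicator {n : ℕ} {K ι : Type*} [Field K] (P : ι → Fin n → K) (i : ι)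
    (f : MvPolynomial (Fin n) K) : Prop :=
  f.IsHomogeneous (vNumber P i) ∧ eval (P i) f ≠ 0 ∧ (∀ j, j ≠ i → eval (P j) f = 0) ∧
    f ∈ restrictSupport K (footprint (vanishingIdeal P))

/-- The standard monomial `t^a` is essential: it appears in each standard indicator function. -/
def IsEssential {n : ℕ} {K ι : Type*} [Field K] (P : ι → Fin n → K) (a : Fin n →₀ ℕ) : Prop :=
  a ∈ footprint (vanishingIdeal P) ∧ ∀ i f, IsStandardIndicator P i f → coeff a f ≠ 0

/-! ### Evaluation codes -/

/-- The evaluation map `f ↦ (f(P_1), …, f(P_m))`; its restriction to `S_d` is `ev_d`. -/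
noncomputable def ev {n m : ℕ} {K : Type*} [Field K] (P : Fin m → Fin n → K) :
    MvPolynomial (Fin n) K →ₗ[K] (Fin m → K) :=
  LinearMap.pi fun i => (aeval (P i)).toLinearMap

/-- The code `ev_d(KΓ)` for a set `Γ` of (exponents of) monomials of degree `d`. -/
noncomputable def evCode {n m : ℕ} {K : Type*} [Field K] (P : Fin m → Fin n → K)
    (Γ : Finset (Fin n →₀ ℕ)) : Submodule K (Fin m → K) :=
  (restrictSupport K (Γ : Set (Fin n →₀ ℕ))).map (ev P)

/-- The dual code `C^⊥` with respect to the ordinary inner product of `K^m`. -/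
def dualCode {m : ℕ} {K : Type*} [Field K] (C : Submodule K (Fin m → K)) :
    Submodule K (Fin m → K) where
  carrier := {x | ∀ y ∈ C, x ⬝ᵥ y = 0}
  zero_mem' := fun y _ => zero_dotProduct y
  add_mem' := fun {x x'} hx hx' y hy => by rw [add_dotProduct, hx y hy, hx' y hy, add_zero]
  smul_mem' := fun c x hx y hy => by rw [smul_dotProduct, hx y hy, smul_zero]

/-- The code `γ · C = {(γ_1 c_1, …, γ_m c_m) | c ∈ C}`. -/
def scaleCode {m : ℕ} {K : Type*} [Field K] (γ : Fin m → K) (C : Submodule K (Fin m → K)) :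
    Submodule K (Fin m → K) :=
  C.map (LinearMap.mulLeft K γ)

end ProjEval

/-! Let `t` be the last variable. It is a non-zero-divisor modulo the vanishing ideal `I`, and the
socle of `S/(I, t)` embeds into `Tor_g(S/I, K)`, where `g` is the projective dimension: passing from
`S/(t)` to `K` one variable at a time, the connecting homomorphisms of the long exact sequences of
`Tor` are injective. Hence this socle has dimension one when `I` is Gorenstein.

An indicator function `f_i` of least degree is a non-zero socle element: on the one hand
`x_j f_i = x_j(P_i) t f_i` modulo `I`, on the other an `f_i` in `(I, t)` could be divided by `t`.
So all the v-numbers agree with one `v`, and `S/(I, t)` vanishes in degrees above `v`, which gives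
`reg(S/I) ≤ v` and makes its part of degree `v` one-dimensional. Thus exactly one standard monomial
`x^a` of degree `v` is prime to `t`, and it occurs in every standard indicator function.

A form `h` of degree `e ≤ v` satisfies `t^(v - e) h = ∑ h(P_i) f_i(P_i)⁻¹ f_i` modulo `I`, as both
sides have the same values. Standard monomials stay standard after multiplication by `t`, so that
comparing coefficients of `x^a` for `h = u₁ u₂` gives the orthogonality of the two codes; equality
follows by counting dimensions. -/

namespace ProjEval

section VarIdeal

variable {σ K : Type*} [Field K]

variable (K) in
/-- The ideal generated by the variables `X v` with `v ∈ s`. -/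
noncomputable def varIdeal (s : Finset σ) : Ideal (MvPolynomial σ K) :=
  Ideal.span (X '' s)

lemma mem_varIdeal {s : Finset σ} {p : MvPolynomial σ K} :
    p ∈ varIdeal K s ↔ ∀ c ∈ p.support, ∃ v ∈ s, c v ≠ 0 :=
  mem_ideal_span_X_image

lemma X_mem_varIdeal {s : Finset σ} {x : σ} (hx : x ∈ s) : X x ∈ varIdeal K s :=
  Ideal.subset_span ⟨x, hx, rfl⟩

lemma varIdeal_mono {s u : Finset σ} (h : s ⊆ u) : varIdeal K s ≤ varIdeal K u :=
  Ideal.span_mono (Set.image_mono h)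

lemma varIdeal_singleton (t : σ) : varIdeal K {t} = Ideal.span {X t} := by
  simp [varIdeal]

lemma X_mul_mem_varIdeal_iff {s : Finset σ} {x : σ} (hx : x ∉ s) {p : MvPolynomial σ K} :
    X x * p ∈ varIdeal K s ↔ p ∈ varIdeal K s := by
  refine ⟨fun h => mem_varIdeal.2 fun c hc => ?_, Ideal.mul_mem_left _ _⟩
  obtain ⟨v, hv, hcv⟩ := mem_varIdeal.1 h (Finsupp.single x 1 + c) <| by
    rwa [mem_support_iff, coeff_X_mul, ← mem_support_iff]
  have hxv : x ≠ v := fun h => hx (h ▸ hv)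
  exact ⟨v, hv, by simpa [Finsupp.single_apply, hxv] using hcv⟩

lemma exists_sub_X_mul_mem_varIdeal [DecidableEq σ] {s : Finset σ} {x : σ} {p : MvPolynomial σ K}
    (hp : p ∈ varIdeal K (insert x s)) :
    ∃ w, p - X x * w ∈ varIdeal K s ∧ ∀ c ∈ w.support, Finsupp.single x 1 + c ∈ p.support := by
  refine ⟨p.divMonomial (Finsupp.single x 1), mem_varIdeal.2 fun c hc => ?_, fun c hc => ?_⟩
  · rw [sub_eq_of_eq_add' (divMonomial_add_modMonomial_single p x).symm, mem_support_iff] at hc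
    have hxc : ¬ Finsupp.single x 1 ≤ c := fun hle => hc (coeff_modMonomial_of_le _ hle)
    rw [coeff_modMonomial_of_not_le _ hxc] at hc
    obtain ⟨v, hv, hcv⟩ := mem_varIdeal.1 hp c (mem_support_iff.2 hc)
    obtain rfl | hv := Finset.mem_insert.1 hv
    · exact absurd (Finsupp.single_le_iff.2 (Nat.one_le_iff_ne_zero.2 hcv)) hxc
    · exact ⟨v, hv, hcv⟩
  · rwa [mem_support_iff, coeff_divMonomial, ← mem_support_iff] at hc

lemma mem_varIdeal_univ [Fintype σ] {p : MvPolynomial σ K} :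
    p ∈ varIdeal K Finset.univ ↔ constantCoeff p = 0 := by
  refine ⟨fun h => ?_, fun h => mem_varIdeal.2 fun c hc => ?_⟩
  · by_contra h0
    obtain ⟨v, -, hv⟩ := mem_varIdeal.1 h 0 (mem_support_iff.2 h0)
    exact hv rfl
  · have hc0 : c ≠ 0 := fun hc0 => mem_support_iff.1 hc (hc0 ▸ h)
    obtain ⟨v, hv⟩ := Finsupp.ne_iff.1 hc0
    exact ⟨v, Finset.mem_univ v, hv⟩

/-- The ideal `(I, X t)` defining the hyperplane section of `S/I` by `X t`. -/
noncomputable def sectionIdeal (I : Ideal (MvPolynomial σ K)) (t : σ) :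
    Ideal (MvPolynomial σ K) :=
  I ⊔ Ideal.span {X t}

lemma mem_sectionIdeal {I : Ideal (MvPolynomial σ K)} {t : σ} {p : MvPolynomial σ K} :
    p ∈ sectionIdeal I t ↔ ∃ q, p - X t * q ∈ I := by
  rw [sectionIdeal, sup_comm, Ideal.mem_span_singleton_sup]
  refine exists_congr fun q => ⟨?_, fun h => ⟨_, h, by ring⟩⟩
  rintro ⟨b, hb, rfl⟩
  rwa [mul_comm, add_sub_cancel_left]

lemma restrictSupport_sup_compl (T : Set (σ →₀ ℕ)) :
    restrictSupport K T ⊔ restrictSupport K Tᶜ = ⊤ := by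
  rw [restrictSupport_eq_span, restrictSupport_eq_span, ← Submodule.span_union, ← Set.image_union,
    Set.union_compl_self, ← restrictSupport_eq_span, restrictSupport_univ]

lemma induction_on_insert_of_mem [DecidableEq σ] {t : σ} {motive : ∀ s : Finset σ, t ∈ s → Prop}
    (singleton : motive {t} (Finset.mem_singleton_self t))
    (insert : ∀ x s (ht : t ∈ s), x ∉ s → motive s ht →
      motive (insert x s) (Finset.mem_insert_of_mem ht))
    {s : Finset σ} (ht : t ∈ s) : motive s ht := by
  suffices h : ∀ u, motive (Insert.insert t u) (Finset.mem_insert_self t u) by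
    simpa only [Finset.insert_eq_self.2 ht] using h s
  intro u
  induction u using Finset.induction_on with
  | empty => exact singleton
  | insert x u _ ih =>
    by_cases hx : x ∈ Insert.insert t u
    · simpa only [Finset.insert_comm t x, Finset.insert_eq_self.2 hx] using ih
    · simpa only [Finset.insert_comm t x] using insert x _ _ hx ih

end VarIdeal

namespace MinGradedFreeResolution

section Complex

variable {σ K : Type*} [Field K] {I : Ideal (MvPolynomial σ K)} (F : MinGradedFreeResolution I)

/-- The free module `F_i`. -/
abbrev Term (i : ℕ) : Type _ := Fin (F.rank i) → MvPolynomial σ K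

/-- The differential `F_{i+1} → F_i`. -/
noncomputable abbrev diff (i : ℕ) : F.Term (i + 1) →ₗ[MvPolynomial σ K] F.Term i :=
  (F.d i).mulVecLin

/-- The submodule `J F_i` of the vectors with entries in `J`. -/
noncomputable def termsIn (J : Ideal (MvPolynomial σ K)) (i : ℕ) :
    Submodule (MvPolynomial σ K) (F.Term i) :=
  Submodule.pi Set.univ fun _ => J

/-- The preimage in `F_i` of the cycles of the complex `F ⊗ S/J`. -/
noncomputable def cyclesMod (J : Ideal (MvPolynomial σ K)) :
    (i : ℕ) → Submodule (MvPolynomial σ K) (F.Term i)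
  | 0 => ⊤
  | i + 1 => (F.termsIn J i).comap (F.diff i)

/-- The preimage in `F_i` of the boundaries of the complex `F ⊗ S/J`. -/
noncomputable def boundariesMod (J : Ideal (MvPolynomial σ K)) (i : ℕ) :
    Submodule (MvPolynomial σ K) (F.Term i) :=
  F.termsIn J i ⊔ LinearMap.range (F.diff i)

/-- The vectors in `F_i` all of whose terms have a degree in `T`, where the basis vector `e_a` of
`F_i` has degree `shift i a`. -/
noncomputable def supportedIn (i : ℕ) (T : Set ℕ) : Submodule K (F.Term i) :=
  Submodule.pi Set.univ fun a => restrictSupport K {c | c.degree + F.shift i a ∈ T}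

/-- The vanishing of `Tor_i(S/I, S/J)` in the internal degrees belonging to `T`. -/
def TorVanishes (J : Ideal (MvPolynomial σ K)) (i : ℕ) (T : Set ℕ) : Prop :=
  ∀ z ∈ F.cyclesMod J i, z ∈ F.supportedIn i T → z ∈ F.boundariesMod J i

variable {F} {J : Ideal (MvPolynomial σ K)} {i : ℕ} {T : Set ℕ}

lemma mem_termsIn {z : F.Term i} : z ∈ F.termsIn J i ↔ ∀ a, z a ∈ J := by
  simp [termsIn]

lemma termsIn_mono {J' : Ideal (MvPolynomial σ K)} (h : J ≤ J') :
    F.termsIn J i ≤ F.termsIn J' i :=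
  Submodule.pi_mono fun _ _ => h

lemma smul_mem_termsIn {x : MvPolynomial σ K} (hx : x ∈ J) (z : F.Term i) :
    x • z ∈ F.termsIn J i :=
  mem_termsIn.2 fun _ => J.mul_mem_right _ hx

lemma diff_apply (z : F.Term (i + 1)) (b : Fin (F.rank i)) :
    F.diff i z b = ∑ a, F.d i b a * z a :=
  rfl

lemma constantCoeff_diff (z : F.Term (i + 1)) (b : Fin (F.rank i)) :
    constantCoeff (F.diff i z b) = 0 := by
  simp [diff_apply, F.minimal]

lemma diff_mem_termsIn {z : F.Term (i + 1)} (hz : z ∈ F.termsIn J (i + 1)) :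
    F.diff i z ∈ F.termsIn J i := by
  refine mem_termsIn.2 fun b => ?_
  rw [diff_apply]
  exact sum_mem fun a _ => J.mul_mem_left _ (mem_termsIn.1 hz a)

lemma mem_boundariesMod {z : F.Term i} :
    z ∈ F.boundariesMod J i ↔ ∃ c, z - F.diff i c ∈ F.termsIn J i := by
  rw [boundariesMod, Submodule.mem_sup]
  constructor
  · rintro ⟨y, hy, _, ⟨c, rfl⟩, rfl⟩
    exact ⟨c, by rwa [add_sub_cancel_right]⟩
  · rintro ⟨c, hc⟩
    exact ⟨_, hc, _, ⟨c, rfl⟩, sub_add_cancel _ _⟩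

lemma boundariesMod_mono {J' : Ideal (MvPolynomial σ K)} (h : J ≤ J') :
    F.boundariesMod J i ≤ F.boundariesMod J' i :=
  sup_le_sup_right (termsIn_mono h) _

lemma mem_boundariesMod_zero {z : F.Term 0} :
    z ∈ F.boundariesMod J 0 ↔ ∀ a, z a ∈ I ⊔ J := by
  rw [mem_boundariesMod]
  constructor
  · rintro ⟨c, hc⟩ a
    have h := add_mem (Ideal.mem_sup_left ((F.range_zero _).1 ⟨c, rfl⟩ a))
      (Ideal.mem_sup_right (mem_termsIn.1 hc a))
    rwa [Pi.sub_apply, add_sub_cancel] at h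
  · intro h
    choose p hp q hq hpq using fun a => Submodule.mem_sup.1 (h a)
    obtain ⟨c, hc⟩ := (F.range_zero p).2 hp
    exact ⟨c, mem_termsIn.2 fun a => by simpa [hc, ← hpq] using hq a⟩

lemma diff_diff (z : F.Term (i + 2)) : F.diff i (F.diff (i + 1) z) = 0 :=
  LinearMap.mem_ker.1 <| (F.exact i).ge ⟨z, rfl⟩

lemma exists_diff_eq {z : F.Term (i + 1)} (hz : F.diff i z = 0) : ∃ c, F.diff (i + 1) c = z :=
  (F.exact i).le hz

lemma mem_supportedIn {z : F.Term i} :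
    z ∈ F.supportedIn i T ↔ ∀ a, ∀ c ∈ (z a).support, c.degree + F.shift i a ∈ T := by
  simp [supportedIn, mem_restrictSupport_iff, Set.subset_def]

lemma supportedIn_univ : F.supportedIn i Set.univ = ⊤ := by
  ext z
  simp [mem_supportedIn]

lemma exists_sub_mem_supportedIn_compl (z : F.Term i) (T : Set ℕ) :
    ∃ y ∈ F.supportedIn i T, z - y ∈ F.supportedIn i Tᶜ := by
  have h (a) : z a ∈ restrictSupport K {c | c.degree + F.shift i a ∈ T} ⊔
      restrictSupport K {c | c.degree + F.shift i a ∈ T}ᶜ := by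
    rw [restrictSupport_sup_compl]
    trivial
  choose y hy w hw hyw using fun a => Submodule.mem_sup.1 (h a)
  obtain rfl : y + w = z := funext hyw
  refine ⟨y, fun a _ => hy a, ?_⟩
  rw [add_sub_cancel_left]
  exact fun a _ => hw a

lemma diff_mem_supportedIn {z : F.Term (i + 1)} (hz : z ∈ F.supportedIn (i + 1) T) :
    F.diff i z ∈ F.supportedIn i T := by
  classical
  rw [mem_supportedIn] at hz ⊢
  intro b c hc
  rw [diff_apply] at hc
  obtain ⟨a, -, ha⟩ := Finset.mem_biUnion.1 (support_sum hc)
  obtain ⟨c₁, h₁, c₂, h₂, rfl⟩ := Finset.mem_add.1 (support_mul _ _ ha)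
  obtain ⟨e, he, hom⟩ := F.graded i b a (ne_zero_iff.2 ⟨c₁, mem_support_iff.1 h₁⟩)
  have hc₁ : c₁.degree = e := (hom.degree_eq_sum_deg_support h₁).symm
  rw [map_add, hc₁, add_right_comm, he, add_comm]
  exact hz a c₂ h₂

lemma X_smul_mem_supportedIn {z : F.Term i} {x : σ} (hz : z ∈ F.supportedIn i ((· + 1) ⁻¹' T)) :
    (X x : MvPolynomial σ K) • z ∈ F.supportedIn i T := by
  rw [mem_supportedIn] at hz ⊢
  intro a c hc
  rw [Pi.smul_apply, smul_eq_mul, support_X_mul] at hc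
  obtain ⟨e, he, rfl⟩ := Finset.mem_map.1 hc
  simpa [add_comm, add_left_comm] using hz a e he

lemma exists_mem_supportedIn_of_mem_boundariesMod {s : Finset σ} {z : F.Term i}
    (hz : z ∈ F.boundariesMod (varIdeal K s) i) (hT : z ∈ F.supportedIn i T) :
    ∃ c ∈ F.supportedIn (i + 1) T, z - F.diff i c ∈ F.termsIn (varIdeal K s) i := by
  obtain ⟨c, hc⟩ := mem_boundariesMod.1 hz
  obtain ⟨y, hy, hcy⟩ := exists_sub_mem_supportedIn_compl c T
  refine ⟨y, hy, mem_termsIn.2 fun a => mem_varIdeal.2 fun e he => ?_⟩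
  have heT := mem_supportedIn.1 (sub_mem hT (diff_mem_supportedIn hy)) a e he
  have he0 : coeff e (F.diff i (c - y) a) = 0 := by
    by_contra h
    exact mem_supportedIn.1 (diff_mem_supportedIn hcy) a e (mem_support_iff.2 h) heT
  have hsub : z - F.diff i c = (z - F.diff i y) - F.diff i (c - y) := by
    rw [map_sub]
    abel
  refine mem_varIdeal.1 (mem_termsIn.1 hc a) e ?_
  rwa [hsub, mem_support_iff, Pi.sub_apply, coeff_sub, he0, sub_zero, ← mem_support_iff]

lemma exists_sub_X_smul_mem_termsIn [DecidableEq σ] {s : Finset σ} {x : σ} {z : F.Term i}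
    (hz : z ∈ F.termsIn (varIdeal K (insert x s)) i) (hT : z ∈ F.supportedIn i T) :
    ∃ w ∈ F.supportedIn i ((· + 1) ⁻¹' T),
      z - (X x : MvPolynomial σ K) • w ∈ F.termsIn (varIdeal K s) i := by
  choose w hw hwz using fun a => exists_sub_X_mul_mem_varIdeal (mem_termsIn.1 hz a)
  refine ⟨w, mem_supportedIn.2 fun a c hc => ?_, mem_termsIn.2 hw⟩
  simpa [add_comm, add_left_comm] using mem_supportedIn.1 hT a _ (hwz a c hc)

lemma X_smul_mem_termsIn_iff {s : Finset σ} {x : σ} (hx : x ∉ s) {z : F.Term i} :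
    (X x : MvPolynomial σ K) • z ∈ F.termsIn (varIdeal K s) i ↔
      z ∈ F.termsIn (varIdeal K s) i := by
  simp [mem_termsIn, X_mul_mem_varIdeal_iff hx]

lemma mem_cyclesMod_of_X_smul_diff {s : Finset σ} {x : σ} (hx : x ∉ s) {z : F.Term (i + 1)}
    {w : F.Term i}
    (h : F.diff i z - (X x : MvPolynomial σ K) • w ∈ F.termsIn (varIdeal K s) i) :
    w ∈ F.cyclesMod (varIdeal K s) i := by
  cases i with
  | zero => trivial
  | succ i =>
    have h := diff_mem_termsIn h
    rwa [map_sub, diff_diff, zero_sub, neg_mem_iff, map_smul, X_smul_mem_termsIn_iff hx] at h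

lemma TorVanishes.mono {T' : Set ℕ} (h : F.TorVanishes J i T') (hT : T ⊆ T') :
    F.TorVanishes J i T :=
  fun z hz hzT => h z hz <| mem_supportedIn.2 fun a c hc => hT (mem_supportedIn.1 hzT a c hc)

lemma TorVanishes.mono_zero {J' : Ideal (MvPolynomial σ K)} (h : F.TorVanishes J 0 T)
    (hJ : J ≤ J') : F.TorVanishes J' 0 T :=
  fun z _ hz => boundariesMod_mono hJ (h z trivial hz)

/-- The long exact sequence of the `Tor_i(S/I, -)` of `0 → S/J(-1) → S/J → S/(J, x) → 0`. -/
lemma TorVanishes.insert_succ [DecidableEq σ] {s : Finset σ} {x : σ} (hx : x ∉ s)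
    (h₁ : F.TorVanishes (varIdeal K s) i ((· + 1) ⁻¹' T))
    (h₂ : F.TorVanishes (varIdeal K s) (i + 1) T) :
    F.TorVanishes (varIdeal K (insert x s)) (i + 1) T := by
  intro z hz hzT
  obtain ⟨w, hwT, hw⟩ := exists_sub_X_smul_mem_termsIn hz (diff_mem_supportedIn hzT)
  obtain ⟨w', hw'T, hw'⟩ := exists_mem_supportedIn_of_mem_boundariesMod
    (h₁ w (mem_cyclesMod_of_X_smul_diff hx hw) hwT) hwT
  have hcycle : z - (X x : MvPolynomial σ K) • w' ∈ F.cyclesMod (varIdeal K s) (i + 1) := by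
    have hdiff : F.diff i (z - (X x : MvPolynomial σ K) • w') =
        (F.diff i z - (X x : MvPolynomial σ K) • w) +
          (X x : MvPolynomial σ K) • (w - F.diff i w') := by
      rw [map_sub, map_smul, smul_sub]
      abel
    change F.diff i _ ∈ F.termsIn _ i
    rw [hdiff]
    exact add_mem hw (Submodule.smul_mem _ _ hw')
  have hbdry := h₂ _ hcycle (sub_mem hzT (X_smul_mem_supportedIn hw'T))
  rw [← sub_add_cancel z ((X x : MvPolynomial σ K) • w')]
  exact add_mem (boundariesMod_mono (varIdeal_mono (Finset.subset_insert x s)) hbdry)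
    (Submodule.mem_sup_left (smul_mem_termsIn (X_mem_varIdeal (Finset.mem_insert_self x s)) w'))

lemma torVanishes_singleton_succ {t : σ} (hI : ∀ p, X t * p ∈ I → p ∈ I) :
    F.TorVanishes (varIdeal K {t}) (i + 1) T := by
  intro z hz _
  have hdvd (a) : X t ∣ F.diff i z a := by
    rw [← Ideal.mem_span_singleton, ← varIdeal_singleton]
    exact mem_termsIn.1 hz a
  choose w hw using hdvd
  have hw : F.diff i z = (X t : MvPolynomial σ K) • w := funext hw
  obtain ⟨c, rfl⟩ : ∃ c, F.diff i c = w := by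
    cases i with
    | zero =>
      refine (F.range_zero w).2 fun a => hI _ ?_
      have h := (F.range_zero (F.diff 0 z)).1 ⟨z, rfl⟩ a
      rwa [hw] at h
    | succ i =>
      refine exists_diff_eq ?_
      have h := diff_diff z
      rw [hw, map_smul] at h
      exact (smul_eq_zero.1 h).resolve_left (X_ne_zero t)
  obtain ⟨c', hc'⟩ := exists_diff_eq (z := z - (X t : MvPolynomial σ K) • c) <| by
    rw [map_sub, map_smul, hw, sub_self]
  refine mem_boundariesMod.2 ⟨c', ?_⟩
  rw [hc', sub_sub_cancel]
  exact smul_mem_termsIn (X_mem_varIdeal (Finset.mem_singleton_self t)) c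

theorem torVanishes_of_card_le {t : σ} (hI : ∀ p, X t * p ∈ I → p ∈ I) {s : Finset σ}
    (ht : t ∈ s) (hs : s.card ≤ i) : F.TorVanishes (varIdeal K s) i T := by
  classical
  induction ht using induction_on_insert_of_mem generalizing i T with
  | singleton =>
    obtain ⟨i, rfl⟩ := Nat.exists_eq_add_one.2 hs
    exact torVanishes_singleton_succ hI
  | insert x s _ hx ih =>
    rw [Finset.card_insert_of_notMem hx] at hs
    obtain ⟨i, rfl⟩ := Nat.exists_eq_add_one.2 ((Nat.succ_pos _).trans_le hs)
    exact .insert_succ hx (ih (Nat.succ_le_succ_iff.1 hs)) (ih (Nat.le_of_succ_le hs))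

theorem torVanishes_Ioi {t : σ} (hI : ∀ p, X t * p ∈ I → p ∈ I) {r : ℕ}
    (hr : idealOfVars σ K ^ (r + 1) ≤ sectionIdeal I t) {s : Finset σ} (ht : t ∈ s) :
    F.TorVanishes (varIdeal K s) i (Set.Ioi (r + i)) := by
  classical
  induction ht using induction_on_insert_of_mem generalizing i with
  | singleton =>
    cases i with
    | zero =>
      intro z _ hz
      rw [mem_boundariesMod_zero, varIdeal_singleton]
      refine fun a => hr ((mem_pow_idealOfVars_iff _ _).2 fun c hc => ?_)
      simpa [F.shift_zero, Nat.succ_le_iff] using mem_supportedIn.1 hz a c hc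
    | succ i => exact torVanishes_singleton_succ hI
  | insert x s _ hx ih =>
    cases i with
    | zero => exact ih.mono_zero (varIdeal_mono (Finset.subset_insert x s))
    | succ i => exact .insert_succ hx (ih.mono fun e he => by simpa [← add_assoc] using he) ih

/-- `f ↦ b` is the inverse of the connecting homomorphism, which commutes with multiplication by
`y`. -/
lemma smul_mem_boundariesMod_of_X_smul_sub_diff [DecidableEq σ] {s : Finset σ} {x : σ}
    (htor : F.TorVanishes (varIdeal K s) (i + 1) Set.univ) {f : F.Term i} {b : F.Term (i + 1)}
    (h : (X x : MvPolynomial σ K) • f - F.diff i b ∈ F.termsIn (varIdeal K s) i)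
    {y : MvPolynomial σ K} (hf : y • f ∈ F.boundariesMod (varIdeal K s) i) :
    y • b ∈ F.boundariesMod (varIdeal K (insert x s)) (i + 1) := by
  obtain ⟨c, hc⟩ := mem_boundariesMod.1 hf
  have hcycle : y • b - (X x : MvPolynomial σ K) • c ∈ F.cyclesMod (varIdeal K s) (i + 1) := by
    have hdiff : F.diff i (y • b - (X x : MvPolynomial σ K) • c) =
        (X x : MvPolynomial σ K) • (y • f - F.diff i c) -
          y • ((X x : MvPolynomial σ K) • f - F.diff i b) := by
      rw [map_sub, map_smul, map_smul, smul_sub, smul_sub, smul_comm y (X x)]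
      abel
    change F.diff i _ ∈ F.termsIn _ i
    rw [hdiff]
    exact sub_mem (Submodule.smul_mem _ _ hc) (Submodule.smul_mem _ _ h)
  have hbdry := htor _ hcycle (by rw [supportedIn_univ]; trivial)
  rw [← sub_add_cancel (y • b) ((X x : MvPolynomial σ K) • c)]
  exact add_mem (boundariesMod_mono (varIdeal_mono (Finset.subset_insert x s)) hbdry)
    (Submodule.mem_sup_left (smul_mem_termsIn (X_mem_varIdeal (Finset.mem_insert_self x s)) c))

lemma mem_boundariesMod_of_X_smul_sub_diff [DecidableEq σ] {s : Finset σ} {x : σ} (hx : x ∉ s)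
    {f : F.Term i} {b : F.Term (i + 1)}
    (h : (X x : MvPolynomial σ K) • f - F.diff i b ∈ F.termsIn (varIdeal K s) i)
    (hb : b ∈ F.boundariesMod (varIdeal K (insert x s)) (i + 1)) :
    f ∈ F.boundariesMod (varIdeal K s) i := by
  obtain ⟨e, he⟩ := mem_boundariesMod.1 hb
  obtain ⟨y, -, hy⟩ := exists_sub_X_smul_mem_termsIn (T := Set.univ) he
    (by rw [supportedIn_univ]; trivial)
  refine mem_boundariesMod.2 ⟨y, (X_smul_mem_termsIn_iff hx).1 ?_⟩
  have hdiff : (X x : MvPolynomial σ K) • (f - F.diff i y) =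
      ((X x : MvPolynomial σ K) • f - F.diff i b) +
        F.diff i (b - F.diff (i + 1) e - (X x : MvPolynomial σ K) • y) := by
    rw [map_sub, map_sub, diff_diff, map_smul, smul_sub]
    abel
  rw [hdiff]
  exact add_mem h (diff_mem_termsIn hy)

end Complex

section Betti

variable {σ K : Type*} [Field K] [Fintype σ] {I : Ideal (MvPolynomial σ K)}
  {F : MinGradedFreeResolution I} {i : ℕ}

lemma mem_boundariesMod_univ {z : F.Term i} :
    z ∈ F.boundariesMod (varIdeal K Finset.univ) i ↔ ∀ a, constantCoeff (z a) = 0 := by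
  rw [mem_boundariesMod]
  refine ⟨?_, fun h => ⟨0, mem_termsIn.2 fun a => mem_varIdeal_univ.2 (by simpa using h a)⟩⟩
  rintro ⟨c, hc⟩ a
  have h := mem_varIdeal_univ.1 (mem_termsIn.1 hc a)
  rwa [Pi.sub_apply, map_sub, constantCoeff_diff, sub_zero] at h

lemma mem_cyclesMod_univ (z : F.Term i) : z ∈ F.cyclesMod (varIdeal K Finset.univ) i := by
  cases i with
  | zero => trivial
  | succ i => exact mem_termsIn.2 fun b => mem_varIdeal_univ.2 (constantCoeff_diff z b)

lemma single_notMem_boundariesMod_univ (a : Fin (F.rank i)) :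
    (Pi.single a 1 : F.Term i) ∉ F.boundariesMod (varIdeal K Finset.univ) i := fun h => by
  simpa using mem_boundariesMod_univ.1 h a

theorem rank_eq_zero {t : σ} (hI : ∀ p, X t * p ∈ I → p ∈ I) (hi : Fintype.card σ ≤ i) :
    F.rank i = 0 := by
  by_contra h
  refine single_notMem_boundariesMod_univ ⟨0, Nat.pos_of_ne_zero h⟩ ?_
  exact torVanishes_of_card_le (T := Set.univ) hI (Finset.mem_univ t) hi _ (mem_cyclesMod_univ _)
    (by rw [supportedIn_univ]; trivial)

/-- The connecting homomorphisms, which are injective here, move the classes `f k` up to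
`Tor_g(S/I, K)`, a space of dimension `rank g`. -/
theorem exists_sum_smul_mem_boundariesMod {t : σ} (hI : ∀ p, X t * p ∈ I → p ∈ I) {g : ℕ}
    (hg : Fintype.card σ = g + 1) {ι : Type*} [Fintype ι] (hι : F.rank g < Fintype.card ι)
    (hi : i ≤ g) {s : Finset σ} (ht : t ∈ s) (hs : s.card = i + 1) (f : ι → F.Term i)
    (hf : ∀ k j, (X j : MvPolynomial σ K) • f k ∈ F.boundariesMod (varIdeal K s) i) :
    ∃ c : ι → K, c ≠ 0 ∧ ∑ k, c k • f k ∈ F.boundariesMod (varIdeal K s) i := by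
  classical
  induction hi using Nat.decreasingInduction generalizing s with
  | self =>
    obtain rfl : s = Finset.univ := Finset.card_eq_iff_eq_univ s |>.1 (hs.trans hg.symm)
    have hdep : ¬ LinearIndependent K fun k a => constantCoeff (f k a) := fun h => by
      have hle := h.fintype_card_le_finrank
      rw [Module.finrank_fin_fun] at hle
      exact hle.not_gt hι
    obtain ⟨c, hc, k, hk⟩ := Fintype.not_linearIndependent_iff.1 hdep
    refine ⟨c, fun h => hk (congrFun h k), mem_boundariesMod_univ.2 fun a => ?_⟩
    simpa [MvPolynomial.smul_eq_C_mul] using congrFun hc a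
  | of_succ i hi ih =>
    obtain ⟨x, hx⟩ : ∃ x, x ∉ s := by
      by_contra! h
      rw [← Finset.eq_univ_iff_forall, ← Finset.card_eq_iff_eq_univ] at h
      omega
    choose b hb using fun k => mem_boundariesMod.1 (hf k x)
    obtain ⟨c, hc, hcb⟩ := ih (Finset.mem_insert_of_mem ht)
      (by rw [Finset.card_insert_of_notMem hx, hs]) b fun k j =>
        smul_mem_boundariesMod_of_X_smul_sub_diff (torVanishes_of_card_le hI ht hs.le) (hb k)
          (hf k j)
    refine ⟨c, hc, mem_boundariesMod_of_X_smul_sub_diff hx ?_ hcb⟩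
    simp only [map_sum, LinearMap.map_smul_of_tower, Finset.smul_sum, smul_comm (X x) (c _),
      ← Finset.sum_sub_distrib, ← smul_sub]
    exact sum_mem fun k _ => Submodule.smul_of_tower_mem _ _ (hb k)

/-- The socle of `S/(I, t)` embeds into `Tor_g(S/I, K)`. -/
theorem exists_sum_smul_mem_sectionIdeal {t : σ} (hI : ∀ p, X t * p ∈ I → p ∈ I) {g : ℕ}
    (hg : Fintype.card σ = g + 1) {ι : Type*} [Fintype ι] (hι : F.rank g < Fintype.card ι)
    (f : ι → MvPolynomial σ K) (hf : ∀ k j, X j * f k ∈ sectionIdeal I t) :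
    ∃ c : ι → K, c ≠ 0 ∧ ∑ k, c k • f k ∈ sectionIdeal I t := by
  rw [sectionIdeal, ← varIdeal_singleton] at hf ⊢
  obtain ⟨c, hc, h⟩ := F.exists_sum_smul_mem_boundariesMod hI hg hι (Nat.zero_le g)
    (Finset.mem_singleton_self t) (Finset.card_singleton t) (fun k _ => f k)
    fun k j => mem_boundariesMod_zero.2 fun _ => hf k j
  refine ⟨c, hc, ?_⟩
  simpa using mem_boundariesMod_zero.1 h (Fin.cast F.rank_zero.symm 0)

end Betti

theorem shift_le {σ K : Type*} [Field K] [Finite σ] {I : Ideal (MvPolynomial σ K)}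
    {F : MinGradedFreeResolution I} {i : ℕ} {t : σ} (hI : ∀ p, X t * p ∈ I → p ∈ I)
    {r : ℕ} (hr : idealOfVars σ K ^ (r + 1) ≤ sectionIdeal I t) (a : Fin (F.rank i)) :
    F.shift i a ≤ r + i := by
  cases nonempty_fintype σ
  by_contra h
  refine single_notMem_boundariesMod_univ a ?_
  refine torVanishes_Ioi hI hr (Finset.mem_univ t) _ (mem_cyclesMod_univ _) ?_
  refine mem_supportedIn.2 fun b c hc => ?_
  rcases eq_or_ne b a with rfl | hb
  · exact (not_le.1 h).trans_le (Nat.le_add_left _ _)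
  · simp [Pi.single_eq_of_ne hb] at hc

lemma rank_eq_one {σ K : Type*} [Field K] {I : Ideal (MvPolynomial σ K)}
    {F : MinGradedFreeResolution I} {i j : ℕ} (hj : F.betti i j = 1)
    (hne : ∀ j', j' ≠ j → F.betti i j' = 0) : F.rank i = 1 := by
  have hshift (a : Fin (F.rank i)) : F.shift i a = j := by
    by_contra ha
    have h := hne _ ha
    rw [betti, Finset.card_eq_zero, Finset.filter_eq_empty_iff] at h
    exact h (Finset.mem_univ a) rfl
  simpa [betti, hshift] using hj

lemma ne_top {σ K : Type*} [Field K] {I : Ideal (MvPolynomial σ K)}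
    (F : MinGradedFreeResolution I) : I ≠ ⊤ := fun h => by
  obtain ⟨c, hc⟩ := (F.range_zero fun _ => 1).2 fun _ => h ▸ trivial
  have h := constantCoeff_diff c (Fin.cast F.rank_zero.symm 0)
  rw [show F.diff 0 c = _ from hc, map_one] at h
  exact one_ne_zero h

end MinGradedFreeResolution

section Gorenstein

variable {σ K : Type*} [Field K] {I : Ideal (MvPolynomial σ K)} {t : σ}

lemma IsGorenstein.ne_top (hG : IsGorenstein I) : I ≠ ⊤ :=
  hG.choose.ne_top

/-- The non-zero socle forces the last module of the resolution into position `|σ| - 1`. -/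
theorem IsGorenstein.exists_sub_smul_mem_sectionIdeal [Finite σ] (hG : IsGorenstein I)
    (hI : ∀ p, X t * p ∈ I → p ∈ I) {f h : MvPolynomial σ K}
    (hf : ∀ j, X j * f ∈ sectionIdeal I t) (hf0 : f ∉ sectionIdeal I t)
    (hh : ∀ j, X j * h ∈ sectionIdeal I t) : ∃ c : K, h - c • f ∈ sectionIdeal I t := by
  cases nonempty_fintype σ
  obtain ⟨F, l, ⟨hl, hmax⟩, j, hj, hne⟩ := hG
  obtain ⟨g, hg⟩ := Nat.exists_eq_add_one.2 (Fintype.card_pos_iff.2 ⟨t⟩)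
  have hf_smul {a : K} (ha : a • f ∈ sectionIdeal I t) : a = 0 := by
    by_contra ha0
    exact hf0 (by simpa [smul_smul, ha0] using Submodule.smul_of_tower_mem _ a⁻¹ ha)
  have hg0 : F.rank g ≠ 0 := fun h0 => by
    obtain ⟨c, hc, hmem⟩ := F.exists_sum_smul_mem_sectionIdeal hI hg (ι := Unit) (by simp [h0])
      (fun _ => f) fun _ => hf
    exact hc (funext fun _ => hf_smul (by simpa using hmem))
  have hlg : l = g := by
    refine le_antisymm (not_lt.1 fun hlt => hl ?_) (hmax hg0)
    exact F.rank_eq_zero hI (hg.trans_le hlt)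
  obtain ⟨c, hc, hmem⟩ := F.exists_sum_smul_mem_sectionIdeal hI hg (ι := Fin 2)
    (by simp [← hlg, F.rank_eq_one hj hne]) ![f, h] (by simpa [Fin.forall_fin_two] using ⟨hf, hh⟩)
  simp only [Fin.sum_univ_two, Matrix.cons_val_zero, Matrix.cons_val_one] at hmem
  have hc1 : c 1 ≠ 0 := fun h1 => by
    rw [h1, zero_smul, add_zero] at hmem
    exact hc (funext (Fin.forall_fin_two.2 ⟨hf_smul hmem, h1⟩))
  refine ⟨-((c 1)⁻¹ * c 0), ?_⟩
  simpa [smul_smul, hc1, add_comm] using Submodule.smul_of_tower_mem _ (c 1)⁻¹ hmem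

theorem reg_le [Finite σ] (hI : ∀ p, X t * p ∈ I → p ∈ I) {r : ℕ}
    (hr : idealOfVars σ K ^ (r + 1) ≤ sectionIdeal I t) : reg I ≤ r := by
  unfold reg
  set R : Set ℤ := {l | ∃ (F : MinGradedFreeResolution I) (i j : ℕ),
    F.betti i j ≠ 0 ∧ l = (j : ℤ) - (i : ℤ)}
  have hR : (r : ℤ) ∈ upperBounds R := by
    rintro _ ⟨F, i, j, hb, rfl⟩
    obtain ⟨a, ha⟩ := Finset.card_ne_zero.1 hb
    have hshift := F.shift_le hI hr a
    rw [(Finset.mem_filter.1 ha).2] at hshift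
    omega
  rcases R.eq_empty_or_nonempty with h | h
  · rw [h, Int.csSup_empty]
    exact Int.natCast_nonneg r
  · exact csSup_le h hR

end Gorenstein

section VanishingIdeal

attribute [local instance] MvPolynomial.gradedAlgebra

variable {n : ℕ} {K ι : Type*} [Field K] {P : ι → Fin n → K} {t : Fin n}

lemma homogeneousComponent_mul_of_isHomogeneous {σ : Type*} {f : MvPolynomial σ K} {e : ℕ}
    (hf : f.IsHomogeneous e) (d : ℕ) (g : MvPolynomial σ K) :
    homogeneousComponent (d + e) (g * f) = homogeneousComponent d g * f := by
  rw [← decomposition.decompose'_apply, ← decomposition.decompose'_apply]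
  exact DirectSum.coe_decompose_mul_add_of_right_mem (homogeneousSubmodule σ K)
    ((mem_homogeneousSubmodule e f).2 hf)

lemma isHomogeneous_vanishingIdeal (P : ι → Fin n → K) :
    (vanishingIdeal P).IsHomogeneous (homogeneousSubmodule (Fin n) K) :=
  Ideal.homogeneous_span _ _ fun _ hf => hf.1

lemma isHomogeneous_sectionIdeal {σ : Type*} {I : Ideal (MvPolynomial σ K)} (t : σ)
    (hI : I.IsHomogeneous (homogeneousSubmodule σ K)) :
    (sectionIdeal I t).IsHomogeneous (homogeneousSubmodule σ K) := by
  refine hI.sup (Ideal.homogeneous_span _ _ ?_)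
  rintro _ rfl
  exact ⟨1, isHomogeneous_X _ _⟩

lemma eval_eq_zero_of_mem_vanishingIdeal {f : MvPolynomial (Fin n) K}
    (hf : f ∈ vanishingIdeal P) (i : ι) : eval (P i) f = 0 := by
  have hle : vanishingIdeal P ≤ RingHom.ker (eval (P i)) := Ideal.span_le.2 fun g hg => hg.2 i
  exact hle hf

lemma mem_vanishingIdeal_of_isHomogeneous {f : MvPolynomial (Fin n) K} {d : ℕ}
    (hf : f.IsHomogeneous d) (h : ∀ i, eval (P i) f = 0) : f ∈ vanishingIdeal P :=
  Ideal.subset_span ⟨⟨d, hf⟩, h⟩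

lemma mem_vanishingIdeal {f : MvPolynomial (Fin n) K} :
    f ∈ vanishingIdeal P ↔ ∀ d i, eval (P i) (homogeneousComponent d f) = 0 := by
  rw [mem_iff_homogeneousComponent_mem (isHomogeneous_vanishingIdeal P)]
  exact forall_congr' fun d => ⟨eval_eq_zero_of_mem_vanishingIdeal,
    mem_vanishingIdeal_of_isHomogeneous (homogeneousComponent_isHomogeneous d f)⟩

lemma mem_pointIdeal {p : Fin n → K} {f : MvPolynomial (Fin n) K} :
    f ∈ pointIdeal p ↔ ∀ d, eval p (homogeneousComponent d f) = 0 := by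
  simp only [pointIdeal, mem_vanishingIdeal, forall_const]

lemma vanishingIdeal_eq_top [IsEmpty ι] (P : ι → Fin n → K) : vanishingIdeal P = ⊤ :=
  (Ideal.eq_top_iff_one _).2 <|
    mem_vanishingIdeal_of_isHomogeneous (isHomogeneous_one _ _) isEmptyElim

lemma mem_vanishingIdeal_of_X_mul_mem (ht : ∀ i, P i t = 1) {p : MvPolynomial (Fin n) K}
    (h : X t * p ∈ vanishingIdeal P) : p ∈ vanishingIdeal P := by
  rw [mem_vanishingIdeal] at h ⊢
  intro d i
  simpa [mul_comm (X t), homogeneousComponent_mul_of_isHomogeneous (isHomogeneous_X K t), ht]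
    using h (d + 1) i

end VanishingIdeal

section Indicator

variable {n : ℕ} {K ι : Type*} [Field K] {P : ι → Fin n → K} {t : Fin n}

/-- An indicator function of degree `d` of the point `[P i]`: a form of degree `d` that vanishes
at all the points except at `[P i]`. -/
def IsIndicator (P : ι → Fin n → K) (i : ι) (d : ℕ) (f : MvPolynomial (Fin n) K) : Prop :=
  f.IsHomogeneous d ∧ eval (P i) f ≠ 0 ∧ ∀ j, j ≠ i → eval (P j) f = 0

lemma exists_linear_separating (hinj : Function.Injective P) (ht : ∀ i, P i t = 1) {i j : ι}
    (hij : i ≠ j) :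
    ∃ L : MvPolynomial (Fin n) K, L.IsHomogeneous 1 ∧ eval (P i) L ≠ 0 ∧ eval (P j) L = 0 := by
  obtain ⟨l, hl⟩ := Function.ne_iff.1 (hinj.ne hij)
  refine ⟨X l - C (P j l) * X t, (isHomogeneous_X _ _).sub (isHomogeneous_C_mul_X _ _), ?_, ?_⟩
  · simpa [ht, sub_eq_zero] using hl
  · simp [ht]

lemma exists_isIndicator [Finite ι] (hinj : Function.Injective P) (ht : ∀ i, P i t = 1) (i : ι) :
    ∃ d f, IsIndicator P i d f := by
  classical
  have := Fintype.ofFinite ι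
  have hL (j : ι) : ∃ L : MvPolynomial (Fin n) K, L.IsHomogeneous 1 ∧ eval (P i) L ≠ 0 ∧
      (j ≠ i → eval (P j) L = 0) := by
    rcases eq_or_ne j i with rfl | hj
    · exact ⟨X t, isHomogeneous_X _ _, by simp [ht], fun h => absurd rfl h⟩
    · obtain ⟨L, hL, hi, hj⟩ := exists_linear_separating hinj ht hj.symm
      exact ⟨L, hL, hi, fun _ => hj⟩
  choose L hL hi hj using hL
  refine ⟨_, ∏ j, L j, IsHomogeneous.prod _ _ (fun _ => 1) fun j _ => hL j, ?_, fun j hji => ?_⟩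
  · rw [map_prod]
    exact Finset.prod_ne_zero_iff.2 fun j _ => hi j
  · rw [map_prod]
    exact Finset.prod_eq_zero (Finset.mem_univ j) (hj j hji)

lemma IsIndicator.colon_eq {i : ι} {d : ℕ} {f : MvPolynomial (Fin n) K}
    (hf : IsIndicator P i d f) : (vanishingIdeal P).colon {f} = pointIdeal (P i) := by
  ext g
  rw [Submodule.mem_colon_singleton, smul_eq_mul, mem_pointIdeal]
  constructor
  · intro h e
    have he := mem_vanishingIdeal.1 h (e + d) i
    rw [homogeneousComponent_mul_of_isHomogeneous hf.1, map_mul] at he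
    exact (mul_eq_zero.1 he).resolve_right hf.2.1
  · intro h
    rw [← sum_homogeneousComponent g, Finset.sum_mul]
    refine sum_mem fun e _ => mem_vanishingIdeal_of_isHomogeneous
      ((homogeneousComponent_isHomogeneous e g).mul hf.1) fun j => ?_
    rcases eq_or_ne j i with rfl | hji
    · rw [map_mul, h, zero_mul]
    · rw [map_mul, hf.2.2 j hji, mul_zero]

lemma isIndicator_of_colon_eq (hinj : Function.Injective P) (ht : ∀ i, P i t = 1) {i : ι} {d : ℕ}
    {f : MvPolynomial (Fin n) K} (hf : f.IsHomogeneous d)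
    (h : (vanishingIdeal P).colon {f} = pointIdeal (P i)) : IsIndicator P i d f := by
  have mem_pointIdeal_iff (g) : g ∈ pointIdeal (P i) ↔ g * f ∈ vanishingIdeal P := by
    rw [← h, Submodule.mem_colon_singleton, smul_eq_mul]
  have hj (j : ι) (hj : j ≠ i) : eval (P j) f = 0 := by
    obtain ⟨L, hL, hLj, hLi⟩ := exists_linear_separating hinj ht hj
    have hLf := (mem_pointIdeal_iff L).1 (mem_vanishingIdeal_of_isHomogeneous hL fun _ => hLi)
    have hval := eval_eq_zero_of_mem_vanishingIdeal hLf j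
    rw [map_mul] at hval
    exact (mul_eq_zero.1 hval).resolve_left hLj
  refine ⟨hf, fun hi => ?_, hj⟩
  have hone : (1 : MvPolynomial (Fin n) K) ∈ pointIdeal (P i) := by
    rw [mem_pointIdeal_iff, one_mul]
    refine mem_vanishingIdeal_of_isHomogeneous hf fun j => ?_
    rcases eq_or_ne j i with rfl | hji
    exacts [hi, hj j hji]
  simpa using eval_eq_zero_of_mem_vanishingIdeal hone ()

lemma vNumber_eq_sInf (hinj : Function.Injective P) (ht : ∀ i, P i t = 1) (i : ι) :
    vNumber P i = sInf {d | ∃ f, IsIndicator P i d f} :=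
  congrArg sInf <| Set.ext fun _ => exists_congr fun _ =>
    ⟨fun h => isIndicator_of_colon_eq hinj ht h.1 h.2, fun h => ⟨h.1, h.colon_eq⟩⟩

lemma exists_isIndicator_vNumber [Finite ι] (hinj : Function.Injective P) (ht : ∀ i, P i t = 1)
    (i : ι) : ∃ f, IsIndicator P i (vNumber P i) f := by
  rw [vNumber_eq_sInf hinj ht]
  exact Nat.sInf_mem (s := {d | ∃ f, IsIndicator P i d f}) (exists_isIndicator hinj ht i)

lemma IsIndicator.vNumber_le (hinj : Function.Injective P) (ht : ∀ i, P i t = 1) {i : ι} {d : ℕ}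
    {f : MvPolynomial (Fin n) K} (hf : IsIndicator P i d f) : vNumber P i ≤ d := by
  rw [vNumber_eq_sInf hinj ht]
  exact Nat.sInf_le ⟨f, hf⟩

lemma IsIndicator.X_mul_mem_sectionIdeal (ht : ∀ i, P i t = 1) {i : ι} {d : ℕ}
    {f : MvPolynomial (Fin n) K} (hf : IsIndicator P i d f) (j : Fin n) :
    X j * f ∈ sectionIdeal (vanishingIdeal P) t := by
  refine mem_sectionIdeal.2 ⟨C (P i j) * f, mem_vanishingIdeal_of_isHomogeneous (d := 1 + d)
    (((isHomogeneous_X _ _).mul hf.1).sub ((isHomogeneous_X _ _).mul (hf.1.C_mul _))) fun l => ?_⟩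
  rcases eq_or_ne l i with rfl | hl
  · simp [ht]
  · simp [hf.2.2 l hl]

/-- An indicator function in `(I, t)` could be divided by `t`, contradicting minimality. -/
lemma IsIndicator.notMem_sectionIdeal (hinj : Function.Injective P) (ht : ∀ i, P i t = 1) {i : ι}
    {f : MvPolynomial (Fin n) K} (hf : IsIndicator P i (vNumber P i) f) :
    f ∉ sectionIdeal (vanishingIdeal P) t := fun h => by
  obtain ⟨g, hg⟩ := mem_sectionIdeal.1 h
  have hv := mem_vanishingIdeal.1 hg (vNumber P i)
  rw [map_sub, homogeneousComponent_eq_self hf.1] at hv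
  rcases hd : vNumber P i with _ | d
  · rw [hd, homogeneousComponent_zero] at hv
    exact hf.2.1 (by simpa [coeff_X_mul'] using hv i)
  · rw [hd, mul_comm, homogeneousComponent_mul_of_isHomogeneous (isHomogeneous_X K t)] at hv
    replace hv (j : ι) : eval (P j) f = eval (P j) (homogeneousComponent d g) := by
      simpa [ht, sub_eq_zero] using hv j
    have hind : IsIndicator P i d (homogeneousComponent d g) :=
      ⟨homogeneousComponent_isHomogeneous d g, hv i ▸ hf.2.1, fun j hj => hv j ▸ hf.2.2 j hj⟩
    have hle := hind.vNumber_le hinj ht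
    omega

variable {v : ι → ℕ} {f : ι → MvPolynomial (Fin n) K} {d r : ℕ}

lemma sub_sum_smul_mem_vanishingIdeal [Fintype ι] (ht : ∀ i, P i t = 1)
    (hf : ∀ i, IsIndicator P i (v i) (f i)) (hd : ∀ i, v i ≤ d) {h : MvPolynomial (Fin n) K}
    (hh : h.IsHomogeneous d) :
    h - ∑ i, (eval (P i) h / eval (P i) (f i)) • (X t ^ (d - v i) * f i) ∈ vanishingIdeal P := by
  refine mem_vanishingIdeal_of_isHomogeneous (d := d) (hh.sub ?_) fun j => ?_
  · refine IsHomogeneous.sum _ _ _ fun i _ => (homogeneousSubmodule (Fin n) K d).smul_mem _ ?_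
    simpa [hd i] using (isHomogeneous_X_pow (R := K) t (d - v i)).mul (hf i).1
  · rw [map_sub, map_sum, Finset.sum_eq_single j, sub_eq_zero]
    · simp [ht, smul_eval, (hf j).2.1]
    · intro i _ hij
      simp [smul_eval, (hf i).2.2 j hij.symm]
    · simp

lemma mem_sectionIdeal_of_isHomogeneous [Finite ι] (ht : ∀ i, P i t = 1)
    (hf : ∀ i, IsIndicator P i (v i) (f i)) (hd : ∀ i, v i < d) {h : MvPolynomial (Fin n) K}
    (hh : h.IsHomogeneous d) : h ∈ sectionIdeal (vanishingIdeal P) t := by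
  have := Fintype.ofFinite ι
  refine (Submodule.sub_mem_iff_left _ (sum_mem fun i _ => Submodule.smul_of_tower_mem _ _ ?_)).1
    (Ideal.mem_sup_left (sub_sum_smul_mem_vanishingIdeal ht hf (fun i => (hd i).le) hh))
  have hX : X t ∈ sectionIdeal (vanishingIdeal P) t :=
    Ideal.mem_sup_right (Ideal.mem_span_singleton_self _)
  exact Ideal.mul_mem_right _ _ (Ideal.pow_mem_of_mem _ hX _ (Nat.sub_pos_of_lt (hd i)))

lemma idealOfVars_pow_le_sectionIdeal [Finite ι] (ht : ∀ i, P i t = 1)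
    (hf : ∀ i, IsIndicator P i (v i) (f i)) (hr : ∀ i, v i ≤ r) :
    idealOfVars (Fin n) K ^ (r + 1) ≤ sectionIdeal (vanishingIdeal P) t := fun p hp => by
  rw [mem_iff_homogeneousComponent_mem
    (isHomogeneous_sectionIdeal t (isHomogeneous_vanishingIdeal P))]
  intro d
  rcases lt_or_ge r d with hd | hd
  · exact mem_sectionIdeal_of_isHomogeneous ht hf (fun i => (hr i).trans_lt hd)
      (homogeneousComponent_isHomogeneous d p)
  · rw [homogeneousComponent_eq_zero' _ _ fun c hc => ?_]
    · exact zero_mem _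
    · have hrc := (mem_pow_idealOfVars_iff _ _).1 hp c hc
      omega

theorem reg_vanishingIdeal_le [Finite ι] (hinj : Function.Injective P) (ht : ∀ i, P i t = 1)
    (hr : ∀ i, vNumber P i ≤ r) : reg (vanishingIdeal P) ≤ r := by
  choose f hf using exists_isIndicator_vNumber hinj ht
  exact reg_le (fun _ => mem_vanishingIdeal_of_X_mul_mem ht)
    (idealOfVars_pow_le_sectionIdeal ht hf hr)

theorem vNumber_eq_vNumber [Finite ι] (hinj : Function.Injective P) (ht : ∀ i, P i t = 1)
    (hG : IsGorenstein (vanishingIdeal P)) (i j : ι) : vNumber P i = vNumber P j := by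
  choose f hf using exists_isIndicator_vNumber hinj ht
  obtain ⟨c, hc⟩ := hG.exists_sub_smul_mem_sectionIdeal
    (fun _ => mem_vanishingIdeal_of_X_mul_mem ht) ((hf i).X_mul_mem_sectionIdeal ht)
    ((hf i).notMem_sectionIdeal hinj ht) ((hf j).X_mul_mem_sectionIdeal ht)
  by_contra hne
  refine (hf j).notMem_sectionIdeal hinj ht ?_
  have hcomp := homogeneousComponent_mem_of_mem
    (isHomogeneous_sectionIdeal t (isHomogeneous_vanishingIdeal P)) hc (vNumber P j)
  rwa [map_sub, map_smul, homogeneousComponent_eq_self (hf j).1,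
    homogeneousComponent_of_mem (hf i).1, if_neg (Ne.symm hne), smul_zero, sub_zero] at hcomp

end Indicator

/-- The exponents of the monomials in `n` variables, ordered by the graded reverse lexicographic
order: exponents of the same degree are compared oppositely to the colexicographic order. -/
def GRevLex (n : ℕ) : Type := Fin n →₀ ℕ

namespace GRevLex

variable {n : ℕ}

noncomputable instance : AddCommMonoid (GRevLex n) :=
  inferInstanceAs (AddCommMonoid (Fin n →₀ ℕ))

/-- The identification of an exponent with the corresponding element of `GRevLex n`. -/
noncomputable def ofExponent : (Fin n →₀ ℕ) ≃+ GRevLex n := AddEquiv.refl (Fin n →₀ ℕ)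

noncomputable instance : LinearOrder (GRevLex n) :=
  LinearOrder.lift'
    (fun a => toLex ((ofExponent.symm a).degree, OrderDual.toDual (toColex (ofExponent.symm a))))
    fun _ _ h => ofExponent.symm.injective
      (toColex.injective (OrderDual.toDual.injective (congrArg Prod.snd (toLex.injective h))))

lemma ofExponent_lt_ofExponent {a b : Fin n →₀ ℕ} :
    ofExponent a < ofExponent b ↔ GRevLexLT a b := by
  change toLex (a.degree, OrderDual.toDual (toColex a)) <
    toLex (b.degree, OrderDual.toDual (toColex b)) ↔ _
  rw [Prod.Lex.toLex_lt_toLex, OrderDual.toDual_lt_toDual, Finsupp.Colex.lt_iff]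
  exact or_congr_right (and_congr_right fun _ => exists_congr fun _ =>
    and_comm.trans (and_congr_right fun _ => forall₂_congr fun _ _ => eq_comm))

lemma monotone_ofExponent : Monotone (ofExponent (n := n)) := fun a b hab => by
  obtain ⟨c, rfl⟩ := exists_add_of_le hab
  rcases eq_or_ne c 0 with rfl | hc
  · rw [add_zero]
  · have hdeg : a.degree < (a + c).degree := by
      simpa [Nat.pos_iff_ne_zero, Finsupp.degree_eq_zero_iff] using hc
    exact (ofExponent_lt_ofExponent.2 (Or.inl hdeg)).le

instance : IsOrderedAddMonoid (GRevLex n) where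
  add_le_add_left a b hab c := by
    rcases hab.eq_or_lt with rfl | hlt
    · exact le_rfl
    obtain ⟨a, rfl⟩ := ofExponent.surjective a
    obtain ⟨b, rfl⟩ := ofExponent.surjective b
    obtain ⟨c, rfl⟩ := ofExponent.surjective c
    rw [ofExponent_lt_ofExponent] at hlt
    rw [← map_add, ← map_add]
    refine (ofExponent_lt_ofExponent.2 ?_).le
    simpa [GRevLexLT] using hlt

instance : WellFoundedLT (GRevLex n) :=
  have := monotone_ofExponent.wellQuasiOrderedLE_of_wellQuasiOrderedLE_of_surjective
    (ofExponent (n := n)).surjective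
  inferInstance

end GRevLex

/-- The graded reverse lexicographic order `≺` as a monomial order. -/
noncomputable def gRevLex (n : ℕ) : MonomialOrder (Fin n) where
  syn := GRevLex n
  toSyn := GRevLex.ofExponent
  toSyn_monotone := GRevLex.monotone_ofExponent

lemma toSyn_gRevLex_lt_toSyn {n : ℕ} {a b : Fin n →₀ ℕ} :
    (gRevLex n).toSyn a < (gRevLex n).toSyn b ↔ GRevLexLT a b :=
  GRevLex.ofExponent_lt_ofExponent

section Footprint

variable {n : ℕ} {K : Type*} [Field K] {I : Ideal (MvPolynomial (Fin n) K)}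

lemma isInitialMonomial_iff {f : MvPolynomial (Fin n) K} {a : Fin n →₀ ℕ} :
    IsInitialMonomial f a ↔ f ≠ 0 ∧ (gRevLex n).degree f = a := by
  constructor
  · intro h
    have hf : f ≠ 0 := support_nonempty.1 ⟨a, h.1⟩
    by_contra hne
    exact ((gRevLex n).le_degree h.1).not_gt (toSyn_gRevLex_lt_toSyn.2
      (h.2 _ ((gRevLex n).degree_mem_support hf) fun h => hne ⟨hf, h⟩))
  · rintro ⟨hf, rfl⟩
    exact ⟨(gRevLex n).degree_mem_support hf, fun b hb hne => toSyn_gRevLex_lt_toSyn.1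
      (((gRevLex n).le_degree hb).lt_of_ne ((gRevLex n).toSyn.injective.ne hne))⟩

lemma notMem_footprint_iff {b : Fin n →₀ ℕ} :
    b ∉ footprint I ↔ ∃ f ∈ I, f ≠ 0 ∧ (gRevLex n).degree f ≤ b := by
  classical
  have hgen : {u : MvPolynomial (Fin n) K | ∃ f ∈ I, ∃ a, IsInitialMonomial f a ∧
      u = monomial a 1} =
      (fun a => monomial a 1) '' {a | ∃ f ∈ I, f ≠ 0 ∧ (gRevLex n).degree f = a} := by
    ext u
    simp only [isInitialMonomial_iff, Set.mem_ofPred_eq, Set.mem_image]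
    grind
  rw [footprint, Set.mem_ofPred_eq, not_not, initialIdeal, hgen, mem_ideal_span_monomial_image,
    support_monomial, if_neg one_ne_zero]
  simp only [Finset.mem_singleton, forall_eq, Set.mem_ofPred_eq]
  grind

lemma eq_zero_of_mem_of_mem_restrictSupport {f : MvPolynomial (Fin n) K} (hf : f ∈ I)
    (hfΔ : f ∈ restrictSupport K (footprint I)) : f = 0 := by
  by_contra h0
  exact notMem_footprint_iff.2 ⟨f, hf, h0, le_rfl⟩
    ((mem_restrictSupport_iff K).1 hfΔ ((gRevLex n).degree_mem_support h0))

theorem exists_isRemainder (I : Ideal (MvPolynomial (Fin n) K)) (f : MvPolynomial (Fin n) K) :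
    ∃ r, IsRemainder I f r := by
  obtain ⟨g, r, hfr, -, hr⟩ := (gRevLex n).div_set (B := {b | b ∈ I ∧ b ≠ 0})
    (fun b hb => (((gRevLex n).leadingCoeff_ne_zero_iff).2 hb.2).isUnit) f
  refine ⟨r, (mem_restrictSupport_iff K).2 fun c hc => ?_, _, ?_, hfr⟩
  · by_contra hcΔ
    obtain ⟨b, hb, hb0, hbc⟩ := notMem_footprint_iff.1 hcΔ
    exact hr c hc b ⟨hb, hb0⟩ hbc
  · exact sum_mem fun b _ => Ideal.mul_mem_left _ _ b.2.1

lemma homogeneousComponent_mem_restrictSupport {σ : Type*} {Δ : Set (σ →₀ ℕ)}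
    {f : MvPolynomial σ K} (hf : f ∈ restrictSupport K Δ) (d : ℕ) :
    homogeneousComponent d f ∈ restrictSupport K Δ := by
  rw [mem_restrictSupport_iff] at hf ⊢
  rw [support_homogeneousComponent]
  exact (Finset.coe_subset.2 (Finset.filter_subset _ _)).trans hf

end Footprint

section LastVariable

variable {n : ℕ} {K ι : Type*} [Field K] {P : ι → Fin (n + 1) → K}

lemma gRevLexLT_of_degree_eq_of_last_lt {a b : Fin (n + 1) →₀ ℕ} (hdeg : a.degree = b.degree)
    (hlast : b (Fin.last n) < a (Fin.last n)) : GRevLexLT a b :=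
  Or.inr ⟨hdeg, Fin.last n, hlast, fun i hi => absurd (Fin.le_last i) hi.not_ge⟩

lemma degree_homogeneousComponent_degree {f : MvPolynomial (Fin n) K} (hf : f ≠ 0) :
    (gRevLex n).degree (homogeneousComponent ((gRevLex n).degree f).degree f) =
      (gRevLex n).degree f := by
  have hinit := isInitialMonomial_iff.2 ⟨hf, rfl⟩
  refine (isInitialMonomial_iff.1 ⟨?_, fun b hb => hinit.2 b ?_⟩).2
  · rw [support_homogeneousComponent]
    exact Finset.mem_filter.2 ⟨hinit.1, rfl⟩
  · rw [support_homogeneousComponent] at hb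
    exact (Finset.mem_filter.1 hb).1

lemma X_last_dvd_of_isHomogeneous {f : MvPolynomial (Fin (n + 1)) K} {d : ℕ}
    (hf : f.IsHomogeneous d) (h : (gRevLex (n + 1)).degree f (Fin.last n) ≠ 0) :
    X (Fin.last n) ∣ f := by
  have hf0 : f ≠ 0 := by
    rintro rfl
    simp at h
  obtain ⟨hmem, hmax⟩ := isInitialMonomial_iff.2 ⟨hf0, rfl⟩
  rw [← Ideal.mem_span_singleton, ← Set.image_singleton, mem_ideal_span_X_image]
  refine fun c hc => ⟨Fin.last n, rfl, fun hc0 => ?_⟩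
  have hne : c ≠ (gRevLex (n + 1)).degree f := by
    rintro rfl
    exact h hc0
  have hdeg : ((gRevLex (n + 1)).degree f).degree = c.degree :=
    (hf.degree_eq_sum_deg_support hmem).symm.trans (hf.degree_eq_sum_deg_support hc)
  have hlt := toSyn_gRevLex_lt_toSyn.2 (hmax c hc hne)
  exact hlt.asymm (toSyn_gRevLex_lt_toSyn.2
    (gRevLexLT_of_degree_eq_of_last_lt hdeg (by omega)))

/-- As `t` is a non-zero-divisor modulo `I`, it does not divide a minimal generator of the initial
ideal. -/
lemma add_single_last_mem_footprint (hlast : ∀ i, P i (Fin.last n) = 1) {b : Fin (n + 1) →₀ ℕ}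
    (hb : b ∈ footprint (vanishingIdeal P)) :
    b + Finsupp.single (Fin.last n) 1 ∈ footprint (vanishingIdeal P) := by
  classical
  by_contra hbt
  obtain ⟨f, hf, hf0, hfb⟩ := notMem_footprint_iff.1 hbt
  set a := (gRevLex (n + 1)).degree f with ha
  have ha0 : a (Fin.last n) ≠ 0 := fun h0 => by
    refine notMem_footprint_iff.2 ⟨f, hf, hf0, fun i => ?_⟩ hb
    have hi := hfb i
    rcases eq_or_ne i (Fin.last n) with rfl | hne
    · rw [← ha, h0]
      exact zero_le
    · simpa [hne] using hi
  have hcomp : (gRevLex (n + 1)).degree (homogeneousComponent a.degree f) = a :=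
    degree_homogeneousComponent_degree hf0
  obtain ⟨q, hq⟩ := X_last_dvd_of_isHomogeneous (homogeneousComponent_isHomogeneous a.degree f)
    (by rwa [hcomp])
  have hqI : q ∈ vanishingIdeal P := mem_vanishingIdeal_of_X_mul_mem hlast
    (hq ▸ homogeneousComponent_mem_of_mem (isHomogeneous_vanishingIdeal P) hf _)
  have hq0 : q ≠ 0 := by
    rintro rfl
    rw [hq, mul_zero, MonomialOrder.degree_zero] at hcomp
    exact ha0 (hcomp ▸ rfl)
  refine notMem_footprint_iff.2 ⟨q, hqI, hq0, ?_⟩ hb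
  rw [hq, MonomialOrder.degree_mul (X_ne_zero _) hq0, MonomialOrder.degree_X] at hcomp
  rw [← hcomp, add_comm b] at hfb
  exact le_of_add_le_add_left hfb

lemma X_last_pow_mul_mem_restrictSupport (hlast : ∀ i, P i (Fin.last n) = 1)
    {f : MvPolynomial (Fin (n + 1)) K}
    (hf : f ∈ restrictSupport K (footprint (vanishingIdeal P))) (e : ℕ) :
    X (Fin.last n) ^ e * f ∈ restrictSupport K (footprint (vanishingIdeal P)) := by
  induction e with
  | zero => simpa using hf
  | succ e ih =>
    rw [pow_succ', mul_assoc, mem_restrictSupport_iff, support_X_mul]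
    intro c hc
    obtain ⟨b, hb, rfl⟩ := Finset.mem_map.1 hc
    rw [addLeftEmbedding_apply, add_comm _ b]
    exact add_single_last_mem_footprint hlast ((mem_restrictSupport_iff K).1 ih hb)

lemma eq_zero_of_mem_sectionIdeal (hlast : ∀ i, P i (Fin.last n) = 1)
    {f : MvPolynomial (Fin (n + 1)) K} (hf : f ∈ sectionIdeal (vanishingIdeal P) (Fin.last n))
    (hfΔ : f ∈ restrictSupport K (footprint (vanishingIdeal P)))
    (h0 : ∀ c ∈ f.support, c (Fin.last n) = 0) : f = 0 := by
  obtain ⟨g, hg⟩ := mem_sectionIdeal.1 hf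
  obtain ⟨r, hr, q, hq, rfl⟩ := exists_isRemainder (vanishingIdeal P) g
  have hfr : f - X (Fin.last n) * r = 0 := by
    refine eq_zero_of_mem_of_mem_restrictSupport (I := vanishingIdeal P) ?_ (sub_mem hfΔ ?_)
    · convert add_mem hg (Ideal.mul_mem_left _ (X (Fin.last n)) hq) using 1
      ring
    · simpa using X_last_pow_mul_mem_restrictSupport hlast hr 1
  by_contra hne
  obtain ⟨c, hc⟩ := support_nonempty.2 hne
  have hc0 := h0 c hc
  rw [sub_eq_zero.1 hfr, support_X_mul] at hc
  obtain ⟨b, -, rfl⟩ := Finset.mem_map.1 hc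
  simp at hc0

end LastVariable

section StandardIndicator

variable {n : ℕ} {K ι : Type*} [Field K] {P : ι → Fin (n + 1) → K} {i : ι}
  {f : MvPolynomial (Fin (n + 1)) K}

lemma IsStandardIndicator.isIndicator (hf : IsStandardIndicator P i f) :
    IsIndicator P i (vNumber P i) f :=
  ⟨hf.1, hf.2.1, hf.2.2.1⟩

lemma IsStandardIndicator.mem_footprintDeg (hf : IsStandardIndicator P i f)
    {c : Fin (n + 1) →₀ ℕ} (hc : c ∈ f.support) :
    c ∈ footprintDeg (vanishingIdeal P) (vNumber P i) :=
  ⟨(mem_restrictSupport_iff K).1 hf.2.2.2 hc, (hf.1.degree_eq_sum_deg_support hc).symm⟩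

lemma exists_isStandardIndicator [Finite ι] (hinj : Function.Injective P)
    (hlast : ∀ i, P i (Fin.last n) = 1) (i : ι) : ∃ f, IsStandardIndicator P i f := by
  obtain ⟨f, hf⟩ := exists_isIndicator_vNumber hinj hlast i
  obtain ⟨r, hr, g, hg, hfr⟩ := exists_isRemainder (vanishingIdeal P) f
  have heval (j : ι) : eval (P j) f = eval (P j) (homogeneousComponent (vNumber P i) r) := by
    have hcomp := congrArg (homogeneousComponent (vNumber P i)) hfr
    rw [homogeneousComponent_eq_self hf.1, map_add] at hcomp
    rw [hcomp, map_add, mem_vanishingIdeal.1 hg, zero_add]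
  exact ⟨homogeneousComponent (vNumber P i) r, homogeneousComponent_isHomogeneous _ _,
    heval i ▸ hf.2.1, fun j hj => heval j ▸ hf.2.2 j hj,
    homogeneousComponent_mem_restrictSupport hr _⟩

lemma IsStandardIndicator.exists_mem_support_last_eq_zero (hinj : Function.Injective P)
    (hlast : ∀ i, P i (Fin.last n) = 1) (hf : IsStandardIndicator P i f) :
    ∃ c ∈ f.support, c (Fin.last n) = 0 := by
  by_contra! h
  refine hf.isIndicator.notMem_sectionIdeal hinj hlast (Ideal.mem_sup_right ?_)
  rw [← Set.image_singleton, mem_ideal_span_X_image]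
  exact fun c hc => ⟨_, rfl, h c hc⟩

lemma eq_of_mem_footprintDeg_vNumber [Finite ι] (hinj : Function.Injective P)
    (hlast : ∀ i, P i (Fin.last n) = 1) (hG : IsGorenstein (vanishingIdeal P)) (i : ι)
    {a b : Fin (n + 1) →₀ ℕ}
    (ha : a ∈ footprintDeg (vanishingIdeal P) (vNumber P i)) (ha0 : a (Fin.last n) = 0)
    (hb : b ∈ footprintDeg (vanishingIdeal P) (vNumber P i)) (hb0 : b (Fin.last n) = 0) :
    a = b := by
  classical
  choose f hf using exists_isIndicator_vNumber hinj hlast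
  have mem_socle (c : Fin (n + 1) →₀ ℕ) (hc : c.degree = vNumber P i) (j : Fin (n + 1)) :
      X j * monomial c (1 : K) ∈ sectionIdeal (vanishingIdeal P) (Fin.last n) := by
    refine mem_sectionIdeal_of_isHomogeneous hlast hf (d := 1 + vNumber P i) (fun l => ?_)
      ((isHomogeneous_X _ _).mul (isHomogeneous_monomial _ hc))
    rw [vNumber_eq_vNumber hinj hlast hG l i]
    omega
  have monomial_mem {c : Fin (n + 1) →₀ ℕ} (hc : c ∈ footprint (vanishingIdeal P)) :
      monomial c (1 : K) ∈ restrictSupport K (footprint (vanishingIdeal P)) :=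
    (monomial_mem_restrictSupport K).2 (Or.inl hc)
  have hane : monomial a (1 : K) ∉ sectionIdeal (vanishingIdeal P) (Fin.last n) := fun hmem => by
    refine one_ne_zero (monomial_eq_zero.1
      (eq_zero_of_mem_sectionIdeal hlast hmem (monomial_mem ha.1) fun c hc => ?_))
    rwa [Finset.mem_singleton.1 (support_monomial_subset hc)]
  obtain ⟨x, hx⟩ := hG.exists_sub_smul_mem_sectionIdeal
    (fun _ => mem_vanishingIdeal_of_X_mul_mem hlast) (mem_socle a ha.2) hane (mem_socle b hb.2)
  have hzero := eq_zero_of_mem_sectionIdeal hlast hx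
    (sub_mem (monomial_mem hb.1) (Submodule.smul_mem _ _ (monomial_mem ha.1))) fun c hc => by
      rcases Finset.mem_union.1 (support_sub _ _ _ hc) with hc | hc
      · rwa [Finset.mem_singleton.1 (support_monomial_subset hc)]
      · rwa [Finset.mem_singleton.1 (support_monomial_subset (support_smul hc))]
  by_contra hab
  simpa [coeff_monomial, hab] using congrArg (coeff b) hzero

theorem existsUnique_isEssential [Finite ι] [Nonempty ι] (hinj : Function.Injective P)
    (hlast : ∀ i, P i (Fin.last n) = 1) (hG : IsGorenstein (vanishingIdeal P)) :
    ∃! a : Fin (n + 1) →₀ ℕ, IsEssential P a ∧ a (Fin.last n) = 0 := by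
  obtain ⟨i₀⟩ := ‹Nonempty ι›
  have mem_footprintDeg {i f c} (hf : IsStandardIndicator P i f) (hc : c ∈ f.support) :
      c ∈ footprintDeg (vanishingIdeal P) (vNumber P i₀) :=
    vNumber_eq_vNumber hinj hlast hG i i₀ ▸ hf.mem_footprintDeg hc
  obtain ⟨f₀, hf₀⟩ := exists_isStandardIndicator hinj hlast i₀
  obtain ⟨a, ha, ha0⟩ := hf₀.exists_mem_support_last_eq_zero hinj hlast
  have eq_a {c} (hc : c ∈ footprintDeg (vanishingIdeal P) (vNumber P i₀))
      (hc0 : c (Fin.last n) = 0) : c = a :=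
    eq_of_mem_footprintDeg_vNumber hinj hlast hG i₀ hc hc0 (mem_footprintDeg hf₀ ha) ha0
  refine ⟨a, ⟨⟨(mem_footprintDeg hf₀ ha).1, fun i f hf => ?_⟩, ha0⟩, fun b ⟨hb, hb0⟩ =>
    eq_a (mem_footprintDeg hf₀ (mem_support_iff.2 (hb.2 i₀ f₀ hf₀))) hb0⟩
  obtain ⟨c, hc, hc0⟩ := hf.exists_mem_support_last_eq_zero hinj hlast
  rw [← eq_a (mem_footprintDeg hf hc) hc0]
  exact mem_support_iff.1 hc

lemma sum_coeff_mul_eval_eq_zero [Fintype ι] (hlast : ∀ i, P i (Fin.last n) = 1)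
    {f : ι → MvPolynomial (Fin (n + 1)) K} (hf : ∀ i, IsStandardIndicator P i (f i)) {v : ℕ}
    (hv : ∀ i, vNumber P i = v) {a : Fin (n + 1) →₀ ℕ} (ha : a (Fin.last n) = 0)
    {e : ℕ} (he : e ≤ v) {h r : MvPolynomial (Fin (n + 1)) K} (hh : h.IsHomogeneous e)
    (hr : IsRemainder (vanishingIdeal P) h r) (har : coeff a r = 0) :
    ∑ i, coeff a (f i) * (eval (P i) (f i))⁻¹ * eval (P i) h = 0 := by
  obtain ⟨hrΔ, g, hg, hgr⟩ := hr
  have hXh : (X (Fin.last n) ^ (v - e) * h).IsHomogeneous v := by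
    simpa [he] using (isHomogeneous_X_pow (R := K) (Fin.last n) (v - e)).mul hh
  have hmem := sub_sum_smul_mem_vanishingIdeal hlast (fun i => (hf i).isIndicator)
    (fun i => (hv i).le) hXh
  simp only [hv, Nat.sub_self, pow_zero, one_mul, map_mul, map_pow, eval_X, hlast, one_pow] at hmem
  have hexpand : X (Fin.last n) ^ (v - e) * r =
      ∑ i, (eval (P i) h / eval (P i) (f i)) • f i := by
    refine sub_eq_zero.1 (eq_zero_of_mem_of_mem_restrictSupport (I := vanishingIdeal P) ?_
      (sub_mem (X_last_pow_mul_mem_restrictSupport hlast hrΔ _)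
        (sum_mem fun i _ => Submodule.smul_mem _ _ (hf i).2.2.2)))
    convert sub_mem hmem (Ideal.mul_mem_left _ (X (Fin.last n) ^ (v - e)) hg) using 1
    rw [hgr]
    ring
  have hcoeff : coeff a (X (Fin.last n) ^ (v - e) * r) = 0 := by
    rcases v - e with _ | s
    · simpa using har
    · rw [pow_succ', mul_assoc, coeff_X_mul', if_neg (by simpa using ha)]
  rw [hexpand, coeff_sum] at hcoeff
  rw [← hcoeff]
  refine Finset.sum_congr rfl fun i _ => ?_
  rw [coeff_smul, smul_eq_mul]
  ring

end StandardIndicator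

section Codes

variable {n m : ℕ} {K : Type*} [Field K]

lemma finrank_add_finrank_dualCode (C : Submodule K (Fin m → K)) :
    Module.finrank K C + Module.finrank K (dualCode C) = m := by
  have hdual : dualCode C =
      C.dualAnnihilator.map ((dotProductEquiv K (Fin m)).symm : Module.Dual K _ →ₗ[K] _) := by
    rw [← Submodule.comap_equiv_eq_map_symm]
    ext x
    rw [Submodule.mem_comap, Submodule.mem_dualAnnihilator]
    exact Iff.rfl
  rw [hdual, LinearEquiv.finrank_map_eq, Subspace.finrank_add_finrank_dualAnnihilator_eq,
    Module.finrank_fin_fun]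

lemma finrank_map_of_disjoint_ker {R V W : Type*} [Ring R] [AddCommGroup V] [Module R V]
    [AddCommGroup W] [Module R W] {f : V →ₗ[R] W} {p : Submodule R V}
    (h : Disjoint p (LinearMap.ker f)) : Module.finrank R (p.map f) = Module.finrank R p := by
  rw [← LinearMap.range_domRestrict]
  exact LinearMap.finrank_range_of_inj (LinearMap.injective_domRestrict_iff.2 h)

lemma finrank_scaleCode {γ : Fin m → K} (hγ : ∀ i, γ i ≠ 0) (C : Submodule K (Fin m → K)) :
    Module.finrank K (scaleCode γ C) = Module.finrank K C :=
  finrank_map_of_disjoint_ker <| LinearMap.disjoint_ker.2 fun _ _ hx =>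
    funext fun i => (mul_eq_zero.1 (congrFun hx i)).resolve_left (hγ i)

lemma isHomogeneous_of_mem_restrictSupport {σ : Type*} {d : ℕ} {Γ : Set (σ →₀ ℕ)}
    (hΓ : ∀ c ∈ Γ, c.degree = d) {p : MvPolynomial σ K} (hp : p ∈ restrictSupport K Γ) :
    p.IsHomogeneous d := by
  rw [p.as_sum]
  exact IsHomogeneous.sum _ _ _ fun c hc => isHomogeneous_monomial _
    (hΓ c ((mem_restrictSupport_iff K).1 hp hc))

lemma finrank_evCode {P : Fin m → Fin n → K} {d : ℕ} {Γ : Finset (Fin n →₀ ℕ)}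
    (hΓ : (Γ : Set (Fin n →₀ ℕ)) ⊆ footprintDeg (vanishingIdeal P) d) :
    Module.finrank K (evCode P Γ) = Γ.card := by
  have hdisj : Disjoint (restrictSupport K (Γ : Set (Fin n →₀ ℕ))) (LinearMap.ker (ev P)) := by
    refine LinearMap.disjoint_ker.2 fun p hp h0 => ?_
    refine eq_zero_of_mem_of_mem_restrictSupport (I := vanishingIdeal P)
      (mem_vanishingIdeal_of_isHomogeneous
        (isHomogeneous_of_mem_restrictSupport (fun c hc => (hΓ hc).2) hp) fun i => ?_)
      (restrictSupport_mono K (fun c hc => (hΓ hc).1) hp)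
    exact congrFun h0 i
  rw [evCode, finrank_map_of_disjoint_ker hdisj,
    Module.finrank_eq_card_basis (basisRestrictSupport K (Γ : Set (Fin n →₀ ℕ)))]
  simp

lemma scaleCode_le_dualCode {P : Fin m → Fin n → K} {γ : Fin m → K} {Γ₁ Γ₂ : Finset (Fin n →₀ ℕ)}
    (h : ∀ u₁ ∈ Γ₁, ∀ u₂ ∈ Γ₂, ∑ i, γ i * eval (P i) (monomial u₁ 1 * monomial u₂ 1) = 0) :
    scaleCode γ (evCode P Γ₁) ≤ dualCode (evCode P Γ₂) := by
  let φ : MvPolynomial (Fin n) K →ₗ[K] K := ∑ i, γ i • (aeval (P i)).toLinearMap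
  have hφ (p) : φ p = ∑ i, γ i * eval (P i) p := by
    simp [φ]
  have hle : restrictSupport K (Γ₁ : Set (Fin n →₀ ℕ)) * restrictSupport K (Γ₂ : Set (Fin n →₀ ℕ))
      ≤ LinearMap.ker φ := by
    rw [restrictSupport_eq_span, restrictSupport_eq_span, Submodule.span_mul_span,
      Submodule.span_le]
    rintro _ ⟨_, ⟨u₁, h₁, rfl⟩, _, ⟨u₂, h₂, rfl⟩, rfl⟩
    exact (hφ _).trans (h u₁ h₁ u₂ h₂)
  rintro _ ⟨_, ⟨p, hp, rfl⟩, rfl⟩ _ ⟨q, hq, rfl⟩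
  have hpq : φ (p * q) = 0 := hle (Submodule.mul_mem_mul hp hq)
  rw [← hpq, hφ]
  exact Finset.sum_congr rfl fun i _ => by simp [ev, mul_assoc]

theorem scaleCode_evCode_eq_dualCode {P : Fin m → Fin (n + 1) → K} (hinj : Function.Injective P)
    (hlast : ∀ i, P i (Fin.last n) = 1) {v : ℕ} (hv : ∀ i, vNumber P i = v)
    {a : Fin (n + 1) →₀ ℕ} (ha : IsEssential P a) (ha0 : a (Fin.last n) = 0)
    {f : Fin m → MvPolynomial (Fin (n + 1)) K} (hf : ∀ i, IsStandardIndicator P i (f i))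
    {d k : ℕ} {Γ₁ Γ₂ : Finset (Fin (n + 1) →₀ ℕ)}
    (h₁ : (Γ₁ : Set (Fin (n + 1) →₀ ℕ)) ⊆ footprintDeg (vanishingIdeal P) d)
    (h₂ : (Γ₂ : Set (Fin (n + 1) →₀ ℕ)) ⊆ footprintDeg (vanishingIdeal P) k)
    (hdk : ((d + k : ℕ) : ℤ) ≤ reg (vanishingIdeal P)) (hcard : Γ₁.card + Γ₂.card = m)
    (hrem : ∀ u₁ ∈ Γ₁, ∀ u₂ ∈ Γ₂, ∀ r,
      IsRemainder (vanishingIdeal P) (monomial u₁ 1 * monomial u₂ 1) r → coeff a r = 0) :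
    scaleCode (fun i => coeff a (f i) * (eval (P i) (f i))⁻¹) (evCode P Γ₁) =
      dualCode (evCode P Γ₂) := by
  have hdkv : d + k ≤ v := by
    exact_mod_cast hdk.trans (reg_vanishingIdeal_le hinj hlast fun i => (hv i).le)
  refine Submodule.eq_of_le_of_finrank_eq (scaleCode_le_dualCode fun u₁ hu₁ u₂ hu₂ => ?_) ?_
  · obtain ⟨r, hr⟩ := exists_isRemainder (vanishingIdeal P)
      (monomial u₁ (1 : K) * monomial u₂ 1)
    exact sum_coeff_mul_eval_eq_zero hlast hf hv ha0 hdkv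
      ((isHomogeneous_monomial _ (h₁ hu₁).2).mul (isHomogeneous_monomial _ (h₂ hu₂).2))
      hr (hrem u₁ hu₁ u₂ hu₂ r hr)
  · have hγ (i) : coeff a (f i) * (eval (P i) (f i))⁻¹ ≠ 0 :=
      mul_ne_zero (ha.2 i _ (hf i)) (inv_ne_zero (hf i).2.1)
    have hdual := finrank_add_finrank_dualCode (evCode P Γ₂)
    rw [finrank_evCode h₂] at hdual
    rw [finrank_scaleCode hγ, finrank_evCode h₁]
    omega

end Codes

end ProjEval

open ProjEval in
theorem mainTheorem11_general {K : Type*} [Field K] (n m : ℕ) (P : Fin m → Fin (n + 1) → K)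
    (hinj : Function.Injective P) (hlast : ∀ i, P i (Fin.last n) = 1)
    (hG : IsGorenstein (vanishingIdeal P)) :
    ∃ a : Fin (n + 1) →₀ ℕ,
      (IsEssential P a ∧ a (Fin.last n) = 0) ∧
      (∀ b, IsEssential P b → b (Fin.last n) = 0 → b = a) ∧
      ∀ f : Fin m → MvPolynomial (Fin (n + 1)) K,
        (∀ i, IsStandardIndicator P i (f i)) →
        ∀ (d k : ℕ) (Γ₁ Γ₂ : Finset (Fin (n + 1) →₀ ℕ)),
          (Γ₁ : Set (Fin (n + 1) →₀ ℕ)) ⊆ footprintDeg (vanishingIdeal P) d →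
          (Γ₂ : Set (Fin (n + 1) →₀ ℕ)) ⊆ footprintDeg (vanishingIdeal P) k →
          ((d + k : ℕ) : ℤ) ≤ reg (vanishingIdeal P) →
          Γ₁.card + Γ₂.card = m →
          (∀ u₁ ∈ Γ₁, ∀ u₂ ∈ Γ₂, ∀ r,
            IsRemainder (vanishingIdeal P) (monomial u₁ 1 * monomial u₂ 1) r → coeff a r = 0) →
          scaleCode (fun i => coeff a (f i) * (eval (P i) (f i))⁻¹) (evCode P Γ₁) =
            dualCode (evCode P Γ₂) := by
  have : Nonempty (Fin m) := by
    by_contra h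
    rw [not_nonempty_iff] at h
    exact hG.ne_top (vanishingIdeal_eq_top P)
  obtain ⟨a, ⟨ha, ha0⟩, hunique⟩ := existsUnique_isEssential hinj hlast hG
  exact ⟨a, ⟨ha, ha0⟩, fun b hb hb0 => hunique b ⟨hb, hb0⟩,
    fun f hf d k Γ₁ Γ₂ h₁ h₂ hdk hcard hrem => scaleCode_evCode_eq_dualCode hinj hlast
      (fun i => vNumber_eq_vNumber hinj hlast hG i (Classical.arbitrary _)) ha ha0 hf h₁ h₂ hdk
      hcard hrem⟩

theorem mainTheorem11 {K : Type*} [Field K] [Finite K] (n m : ℕ) (hm : 2 ≤ m)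
    (P : Fin m → Fin (n + 1) → K) (hP : ∀ i, P i ≠ 0)
    (hinj : Function.Injective fun i => Projectivization.mk K (P i) (hP i))
    (hlast : ∀ i, P i (Fin.last n) = 1)
    (hG : ProjEval.IsGorenstein (ProjEval.vanishingIdeal P)) :
    ∃ a : Fin (n + 1) →₀ ℕ,
      (ProjEval.IsEssential P a ∧ a (Fin.last n) = 0) ∧
      (∀ b, ProjEval.IsEssential P b → b (Fin.last n) = 0 → b = a) ∧
      ∀ f : Fin m → MvPolynomial (Fin (n + 1)) K,
        (∀ i, ProjEval.IsStandardIndicator P i (f i)) →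
        ∀ (d k : ℕ) (Γ₁ Γ₂ : Finset (Fin (n + 1) →₀ ℕ)),
          (Γ₁ : Set (Fin (n + 1) →₀ ℕ)) ⊆
            ProjEval.footprintDeg (ProjEval.vanishingIdeal P) d →
          (Γ₂ : Set (Fin (n + 1) →₀ ℕ)) ⊆
            ProjEval.footprintDeg (ProjEval.vanishingIdeal P) k →
          ((d + k : ℕ) : ℤ) ≤ ProjEval.reg (ProjEval.vanishingIdeal P) →
          Γ₁.card + Γ₂.card = m →
          (∀ u₁ ∈ Γ₁, ∀ u₂ ∈ Γ₂, ∀ r,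
            ProjEval.IsRemainder (ProjEval.vanishingIdeal P)
              (MvPolynomial.monomial u₁ 1 * MvPolynomial.monomial u₂ 1) r →
            MvPolynomial.coeff a r = 0) →
          ProjEval.scaleCode
              (fun i => MvPolynomial.coeff a (f i) * (MvPolynomial.eval (P i) (f i))⁻¹)
              (ProjEval.evCode P Γ₁) =
            ProjEval.dualCode (ProjEval.evCode P Γ₂) := by
  exact mainTheorem11_general n m P (fun i j hij => hinj (by simp only [hij])) hlast hG
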